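/- Theorem (Convergence of exact gradient descent for MAML-LQR). Setting. Let $(A_i,B_i,Q_i,R_i,\Psi_i)_{i\in\mathcal S}$ be a finite family of linear quadratic regulators with common state space $\mathbb R^d$ and control space $\mathbb R^k$, where $A_i\in\mathbb R^{d\times d}$, $B_i\in\mathbb R^{d\times k}$, and $Q_i\in\mathbb R^{d\times d}$, $R_i\in\mathbb R^{k\times k}$, $\Psi_i\in\mathbb R^{d\times d}$ are symmetric positive definite. Let $p$ be a probability distribution on $\mathcal S$ with $p_i>0$ for all $i$, let $\Sigma_0$ be a positive semidefinite $d\times d$ matrix, and let $\eta>0$. For $K\in\mathbb R^{k\times d}$, system $i$ under the policy $u_t=-Kx_t$ evolves by $x_{t+1}=A_ix_t+B_iu_t+w_t$, where $x_0\sim\mathcal N(0,\Sigma_0)$ is independent of the i.i.d. noise $w_t\sim\mathcal N(0,\Psi_i)$. Let $\mathcal K_i=\{K:\rho(A_i-B_iK)<1\}$ be the set of stable gains ($\rho$ is the spectral radius), and let $$J_i(K)=\lim_{T\to\infty}\frac1T\,\mathbb E\Big[\sum_{t=0}^{T-1}\big(x_t^\top Q_ix_t+u_t^\top R_iu_t\big)\Big]$$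 be the ergodic cost, for $K\in\mathcal K_i$. Gradients are taken with respect to the Frobenius inner product, and $\|\cdot\|_F$ is the Frobenius norm. The meta-objective $$\mathcal L(K)=\mathbb E_{i\sim p}\big[J_i\big(K-\eta\nabla J_i(K)\big)\big]$$ is considered on the domain $\mathcal D$ of all $K$ such that $K\in\mathcal K_i$ and $K-\eta\nabla J_i(K)\in\mathcal K_i$ for every $i\in\mathcal S$. Let $K_0\in\mathcal D$ and $\mathcal D_0=\{K\in\mathcal D:\mathcal L(K)\le\mathcal L(K_0)\}$. Call $L>0$ a Lipschitz constant of $\nabla\mathcal L$ on $\mathcal D_0$ under small perturbations if for each $K\in\mathcal D_0$ there is $\delta>0$ such that $\|\nabla\mathcal L(K)-\nabla\mathcal L(K')\|_F\le L\|K-K'\|_F$ for all $K'\in\mathcal D_0$ with $\|K-K'\|_F\le\delta$. (In particular, every Lipschitz constant $L>0$ of $\nabla\mathcal L$ on $\mathcal D_0$ is one.) Claim. 1. If $\mathcal D_0$ is bounded, then $\nabla\mathcal L$ is Lipschitz on $\mathcal D_0$, that is, there is $L>0$ with $\|\nabla\mathcal L(K)-\nabla\mathcal L(K')\|_F\le L\|K-K'\|_F$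 for all $K,K'\in\mathcal D_0$. 2. Let $L>0$ be a Lipschitz constant of $\nabla\mathcal L$ on $\mathcal D_0$ under small perturbations, let $\alpha\in(0,1/L]$, and let $K_{n+1}=K_n-\alpha\nabla\mathcal L(K_n)$ for $n\ge0$ be exact gradient descent started at $K_0$. Then every $K_n$ lies in $\mathcal D$, $\mathcal L$ is differentiable at every $K_n$, and $$\lim_{n\to\infty}\|\nabla\mathcal L(K_n)\|_F=0.$$ -/

import Mathlib

open MeasureTheory ProbabilityTheory Filter Topology

attribute [local instance] Matrix.frobeniusNormedAddCommGroup Matrix.frobeniusNormedSpace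

noncomputable section

namespace MetaLQR

/-- A linear quadratic regulator with state space `ℝ^d` and control space `ℝ^k`: dynamics
`x_{t+1} = A x_t + B u_t + w_t` with `w_t ∼ N(0, Ψ)` i.i.d., and stage cost `xᵀ Q x + uᵀ R u`. -/
structure LQRSystem (d k : ℕ) where
  A : Matrix (Fin d) (Fin d) ℝ
  B : Matrix (Fin d) (Fin k) ℝ
  Q : Matrix (Fin d) (Fin d) ℝ
  R : Matrix (Fin k) (Fin k) ℝ
  Ψ : Matrix (Fin d) (Fin d) ℝ
  hQ : Q.PosDef
  hR : R.PosDef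
  hΨ : Ψ.PosDef

namespace LQRSystem

variable {d k : ℕ}

/-- The set of stable gains: the (complex) spectral radius of `A - B K` is smaller than one. -/
def stableSet (s : LQRSystem d k) : Set (Matrix (Fin k) (Fin d) ℝ) :=
  {K | spectralRadius ℂ ((s.A - s.B * K).map (algebraMap ℝ ℂ)) < 1}

/-- The control `u = -K x` of the linear policy `K` in state `x`. -/
def control (K : Matrix (Fin k) (Fin d) ℝ) (x : Fin d → ℝ) : Fin k → ℝ :=
  -(K.mulVec x)

/-- The state `x_t` of the system under the policy `u_t = -K x_t`, started at `x₀` and driven by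
the noise sequence `w`. -/
def state (s : LQRSystem d k) (K : Matrix (Fin k) (Fin d) ℝ) (x₀ : Fin d → ℝ)
    (w : ℕ → Fin d → ℝ) : ℕ → Fin d → ℝ
  | 0 => x₀
  | t + 1 => s.A.mulVec (s.state K x₀ w t) + s.B.mulVec (control K (s.state K x₀ w t)) + w t

/-- The stage cost `g(x, u) = xᵀ Q x + uᵀ R u`. -/
def stageCost (s : LQRSystem d k) (x : Fin d → ℝ) (u : Fin k → ℝ) : ℝ :=
  x ⬝ᵥ s.Q.mulVec x + u ⬝ᵥ s.R.mulVec u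

/-- The law of `(x₀, (w_t)_t)`: `x₀ ∼ N(0, Σ₀)` is independent of the i.i.d. sequence
`w_t ∼ N(0, Ψ)`. -/
def noiseLaw (s : LQRSystem d k) (S₀ : Matrix (Fin d) (Fin d) ℝ) :
    Measure (EuclideanSpace ℝ (Fin d) × (ℕ → EuclideanSpace ℝ (Fin d))) :=
  (multivariateGaussian 0 S₀).prod (Measure.infinitePi fun _ : ℕ => multivariateGaussian 0 s.Ψ)

/-- The expected cost accumulated over the first `T` steps, `E [∑_{t < T} g(x_t, u_t)]`. -/
def expectedCost (s : LQRSystem d k) (S₀ : Matrix (Fin d) (Fin d) ℝ)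
    (K : Matrix (Fin k) (Fin d) ℝ) (T : ℕ) : ℝ :=
  ∫ z, ∑ t ∈ Finset.range T,
    s.stageCost (s.state K z.1.ofLp (fun n => (z.2 n).ofLp) t)
      (control K (s.state K z.1.ofLp (fun n => (z.2 n).ofLp) t)) ∂(s.noiseLaw S₀)

/-- The ergodic cost `J(K) = lim_{T → ∞} (1 / T) E [∑_{t < T} g(x_t, u_t)]`. -/
def cost (s : LQRSystem d k) (S₀ : Matrix (Fin d) (Fin d) ℝ)
    (K : Matrix (Fin k) (Fin d) ℝ) : ℝ :=
  limUnder atTop fun T : ℕ => (1 / (T : ℝ)) * s.expectedCost S₀ K T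

end LQRSystem

/-- The gradient of a function of a matrix with respect to the Frobenius inner product:
its `(a, b)` entry is the derivative in the direction of the matrix unit `E_{ab}`. -/
def matGradient {k d : ℕ} (f : Matrix (Fin k) (Fin d) ℝ → ℝ) (K : Matrix (Fin k) (Fin d) ℝ) :
    Matrix (Fin k) (Fin d) ℝ :=
  Matrix.of fun a b => fderiv ℝ f K (Matrix.single a b 1)

variable {d k : ℕ} {ι : Type*}

/-- The gain `K - η ∇J(K)` adapted to the system `s` by one policy gradient step. -/
def adapt (s : LQRSystem d k) (S₀ : Matrix (Fin d) (Fin d) ℝ) (η : ℝ)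
    (K : Matrix (Fin k) (Fin d) ℝ) : Matrix (Fin k) (Fin d) ℝ :=
  K - η • matGradient (s.cost S₀) K

/-- The domain of the meta-objective: gains that are stable for every system, and whose
one-step adaptation to each system is stable for that system. -/
def metaDomain (sys : ι → LQRSystem d k) (S₀ : Matrix (Fin d) (Fin d) ℝ) (η : ℝ) :
    Set (Matrix (Fin k) (Fin d) ℝ) :=
  {K | ∀ i, K ∈ (sys i).stableSet ∧ adapt (sys i) S₀ η K ∈ (sys i).stableSet}

/-- The meta-objective `𝓛(K) = E_{i ∼ p} [J_i(K - η ∇J_i(K))]`. -/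
def metaObjective [Fintype ι] (sys : ι → LQRSystem d k) (p : ι → ℝ)
    (S₀ : Matrix (Fin d) (Fin d) ℝ) (η : ℝ) (K : Matrix (Fin k) (Fin d) ℝ) : ℝ :=
  ∑ i, p i * (sys i).cost S₀ (adapt (sys i) S₀ η K)

/-- The set of gains in the domain whose meta-objective does not exceed that of `K₀`. -/
def metaSublevel [Fintype ι] (sys : ι → LQRSystem d k) (p : ι → ℝ)
    (S₀ : Matrix (Fin d) (Fin d) ℝ) (η : ℝ) (K₀ : Matrix (Fin k) (Fin d) ℝ) :
    Set (Matrix (Fin k) (Fin d) ℝ) :=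
  {K | K ∈ metaDomain sys S₀ η ∧ metaObjective sys p S₀ η K ≤ metaObjective sys p S₀ η K₀}

/-- `L` is a Lipschitz constant, in Frobenius norm, for `G` under small perturbations within
`C`: around each `K ∈ C`, `‖G K - G K'‖ ≤ L ‖K - K'‖` for all `K' ∈ C` close enough to `K`.
Every Lipschitz constant of `G` on `C` has this property. -/
def IsPerturbationLipschitzOn (G : Matrix (Fin k) (Fin d) ℝ → Matrix (Fin k) (Fin d) ℝ)
    (C : Set (Matrix (Fin k) (Fin d) ℝ)) (L : ℝ) : Prop :=
  ∀ K ∈ C, ∃ δ > 0, ∀ K' ∈ C, ‖K - K'‖ ≤ δ → ‖G K - G K'‖ ≤ L * ‖K - K'‖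

end MetaLQR

end

noncomputable section

namespace MetaLQR

/-! For a stable gain, `J_i(K) = tr(Σ_K (Q + KᵀRK))`, where the stationary covariance `Σ_K` solves a
discrete Lyapunov equation (`cost_eq`). Inverting the Lyapunov operator is smooth, so `J_i` and the
meta-objective are smooth on their open domains.

The crux is that `𝒟₀` is closed in the whole matrix space (`isClosed_metaSublevel`). A bound on the
meta-objective controls only the costs at the adapted gains, so a priori `K` itself could approach
instability. Coercivity bounds the adapted gains. Along a convergent sequence this bounds `∇J_i(K) =
(K - adapt K)/η`, and gradient dominance (`cost_le_add_norm_matGradient`) then bounds `J_i(K)`.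
Bounded cost bounds `∑ ‖(A - BK)^j‖²`, a certificate of stability that survives limits.

If `𝒟₀` is bounded it is therefore compact, and a `C¹` gradient is Lipschitz on it. For descent, a
continuation argument keeps the segment of a step inside `𝒟₀`: the function decreases strictly along
it, and closedness prevents escape through the boundary. The descent inequality gains `α/2 ‖∇𝓛‖²`
per step; since `𝓛 ≥ 0`, these gains are summable. -/

open Matrix

/-! ### Frobenius norm, traces and semidefinite bounds. -/

section MatrixInequalities

variable {m n : Type*} [Fintype m] [Fintype n]

theorem frobenius_norm_sq_eq_sum (A : Matrix m n ℝ) : ‖A‖ ^ 2 = ∑ i, ∑ j, A i j ^ 2 := by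
  have h0 : (0 : ℝ) ≤ ∑ i, ∑ j, A i j ^ 2 :=
    Finset.sum_nonneg fun i _ => Finset.sum_nonneg fun j _ => sq_nonneg _
  rw [Matrix.frobenius_norm_def]
  simp only [Real.rpow_two, Real.norm_eq_abs, sq_abs]
  rw [← Real.sqrt_eq_rpow, Real.sq_sqrt h0]

theorem trace_transpose_mul_eq_sum (A B : Matrix m n ℝ) :
    trace (Aᵀ * B) = ∑ i, ∑ j, A i j * B i j := by
  simp only [trace, diag_apply, mul_apply, transpose_apply]
  exact Finset.sum_comm

theorem frobenius_norm_sq_eq_trace (A : Matrix m n ℝ) : ‖A‖ ^ 2 = trace (Aᵀ * A) := by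
  rw [frobenius_norm_sq_eq_sum, trace_transpose_mul_eq_sum]
  simp only [sq]

theorem abs_trace_transpose_mul_le (A B : Matrix m n ℝ) : |trace (Aᵀ * B)| ≤ ‖A‖ * ‖B‖ := by
  apply abs_le_of_sq_le_sq _ (by positivity)
  rw [mul_pow, frobenius_norm_sq_eq_sum, frobenius_norm_sq_eq_sum, trace_transpose_mul_eq_sum]
  simp only [← Fintype.sum_prod_type']
  exact Finset.sum_mul_sq_le_sq_mul_sq Finset.univ (fun x : m × n => A x.1 x.2)
    (fun x => B x.1 x.2)

theorem abs_trace_mul_le (A : Matrix m n ℝ) (B : Matrix n m ℝ) : |trace (A * B)| ≤ ‖A‖ * ‖B‖ := by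
  simpa using abs_trace_transpose_mul_le Aᵀ B

/-- Diagonalising `S` turns the trace into a sum of eigenvalues of `S` times diagonal entries of a
conjugate of `Q`, all nonnegative. -/
theorem trace_mul_nonneg {S Q : Matrix n n ℝ} (hS : S.PosSemidef) (hQ : Q.PosSemidef) :
    0 ≤ trace (S * Q) := by
  classical
  have hU := hS.1.spectral_theorem
  set U : Matrix n n ℝ := (hS.1.eigenvectorUnitary : Matrix n n ℝ)
  rw [hU, Unitary.conjStarAlgAut_apply]
  have : trace (U * diagonal (RCLike.ofReal ∘ hS.1.eigenvalues : n → ℝ) * star U * Q)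
      = trace (diagonal hS.1.eigenvalues * (Uᴴ * Q * U)) := by
    rw [Matrix.mul_assoc, Matrix.mul_assoc, trace_mul_comm]
    simp only [Matrix.mul_assoc, star_eq_conjTranspose]
    rfl
  rw [this]
  refine Finset.sum_nonneg fun i _ => ?_
  rw [diag_apply, diagonal_mul]
  exact mul_nonneg (hS.eigenvalues_nonneg i) (hQ.conjTranspose_mul_mul_same U).diag_nonneg

theorem exists_pos_sub_smul_one_posSemidef [DecidableEq n] {Q : Matrix n n ℝ} (hQ : Q.PosDef) :
    ∃ c : ℝ, 0 < c ∧ (Q - c • (1 : Matrix n n ℝ)).PosSemidef := by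
  have hpos := hQ.1.posDef_iff_eigenvalues_pos.1 hQ
  obtain ⟨c, hc, hle⟩ : ∃ c : ℝ, 0 < c ∧ ∀ i, c ≤ hQ.1.eigenvalues i := by
    -- The constant is the smallest eigenvalue; in dimension zero any positive number serves.
    rcases isEmpty_or_nonempty n with h | h
    · exact ⟨1, one_pos, fun i => h.elim i⟩
    · obtain ⟨i, hi⟩ := Finite.exists_min hQ.1.eigenvalues
      exact ⟨_, hpos i, hi⟩
  refine ⟨c, hc, ?_⟩
  have hU := hQ.1.spectral_theorem
  set U : Matrix n n ℝ := (hQ.1.eigenvectorUnitary : Matrix n n ℝ) with hUdef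
  have hUU : U * Uᴴ = 1 := Unitary.coe_mul_star_self hQ.1.eigenvectorUnitary
  have hd : (diagonal fun i => hQ.1.eigenvalues i - c).PosSemidef :=
    PosSemidef.diagonal fun i => sub_nonneg.2 (hle i)
  have key : Q - c • (1 : Matrix n n ℝ) =
      U * (diagonal fun i => hQ.1.eigenvalues i - c) * Uᴴ := by
    have h1 : (diagonal fun i => hQ.1.eigenvalues i - c) =
        diagonal hQ.1.eigenvalues - c • (1 : Matrix n n ℝ) := by
      rw [← diagonal_one, ← diagonal_smul, diagonal_sub]
      congr 1
      ext i
      simp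
    rw [h1, Matrix.mul_sub, Matrix.sub_mul, Matrix.mul_smul, Matrix.smul_mul, Matrix.mul_one, hUU]
    congr 1
  rw [key]
  exact hd.mul_mul_conjTranspose_same U

theorem mul_trace_le_trace_mul [DecidableEq n] {S Q : Matrix n n ℝ} {c : ℝ}
    (hQ : (Q - c • (1 : Matrix n n ℝ)).PosSemidef) (hS : S.PosSemidef) :
    c * trace S ≤ trace (S * Q) := by
  have := trace_mul_nonneg hS hQ
  rw [Matrix.mul_sub, trace_sub, Matrix.mul_smul, Matrix.mul_one, trace_smul, smul_eq_mul] at this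
  linarith

theorem posSemidef_mul_mul_transpose {S : Matrix n n ℝ} (hS : S.PosSemidef) (M : Matrix m n ℝ) :
    (M * S * Mᵀ).PosSemidef := by
  simpa [conjTranspose_eq_transpose_of_trivial] using hS.mul_mul_conjTranspose_same M

theorem posSemidef_transpose_mul_mul {S : Matrix n n ℝ} (hS : S.PosSemidef) (M : Matrix n m ℝ) :
    (Mᵀ * S * M).PosSemidef := by
  simpa [conjTranspose_eq_transpose_of_trivial] using hS.conjTranspose_mul_mul_same M

theorem mul_norm_sq_le_trace [DecidableEq n] {S : Matrix n n ℝ} {c : ℝ}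
    (hS : (S - c • (1 : Matrix n n ℝ)).PosSemidef) (M : Matrix m n ℝ) :
    c * ‖M‖ ^ 2 ≤ trace (M * S * Mᵀ) := by
  have h := (posSemidef_mul_mul_transpose hS M).trace_nonneg
  rw [Matrix.mul_sub, Matrix.sub_mul, trace_sub, Matrix.mul_smul, Matrix.mul_one, Matrix.smul_mul,
    trace_smul, smul_eq_mul, trace_mul_comm M, ← frobenius_norm_sq_eq_trace] at h
  linarith

end MatrixInequalities

/-! ### Stability as convergence of matrix powers to zero. -/

section Stability

variable {n : Type*} [Fintype n] [DecidableEq n]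

/-- A real square matrix is stable if its complex spectral radius is smaller than one. -/
def IsStable (M : Matrix n n ℝ) : Prop :=
  spectralRadius ℂ (M.map (algebraMap ℝ ℂ)) < 1

section

attribute [local instance] Matrix.frobeniusNormedRing Matrix.frobeniusNormedAlgebra

theorem norm_map_pow (M : Matrix n n ℝ) (k : ℕ) :
    ‖M.map (algebraMap ℝ ℂ) ^ k‖ = ‖M ^ k‖ := by
  have : M.map (algebraMap ℝ ℂ) ^ k = (M ^ k).map (algebraMap ℝ ℂ) :=
    (map_pow (algebraMap ℝ ℂ).mapMatrix M k).symm
  rw [this]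
  exact Matrix.frobenius_norm_map_eq _ _ fun a => by simp

theorem IsStable.tendsto_pow {M : Matrix n n ℝ} (hM : IsStable M) :
    Tendsto (fun k => M ^ k) atTop (𝓝 0) := by
  set a : Matrix n n ℂ := M.map (algebraMap ℝ ℂ) with ha
  have : CompleteSpace (Matrix n n ℂ) := FiniteDimensional.complete ℂ _
  have hG := spectrum.pow_nnnorm_pow_one_div_tendsto_nhds_spectralRadius a
  obtain ⟨r, hr1, hr2⟩ := exists_between (show spectralRadius ℂ a < 1 from hM)
  have hev : ∀ᶠ k : ℕ in atTop, ‖M ^ k‖ ≤ r.toReal ^ k := by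
    filter_upwards [hG.eventually_lt_const hr1, eventually_gt_atTop 0] with k hk hk0
    have hk0' : (0 : ℝ) < k := by exact_mod_cast hk0
    have h1 : ((‖a ^ k‖₊ : ENNReal)) ≤ r ^ k := by
      have := ENNReal.rpow_le_rpow hk.le hk0'.le
      rwa [← ENNReal.rpow_mul, one_div_mul_cancel hk0'.ne', ENNReal.rpow_one,
        ENNReal.rpow_natCast] at this
    have h2 := ENNReal.toReal_mono (by finiteness) h1
    rw [ENNReal.toReal_pow] at h2
    rw [← norm_map_pow]
    exact h2
  apply squeeze_zero_norm' hev
  apply tendsto_pow_atTop_nhds_zero_of_lt_one ENNReal.toReal_nonneg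
  have := (ENNReal.toReal_lt_toReal hr2.ne_top ENNReal.one_ne_top).2 hr2
  simpa using this

/-- One small power already forces stability. The factor `‖1‖` is present because the Frobenius norm
of the identity need not be one. -/
theorem isStable_of_norm_pow_lt {M : Matrix n n ℝ} {k : ℕ}
    (h : ‖M ^ (k + 1)‖ * ‖(1 : Matrix n n ℝ)‖ < 1) : IsStable M := by
  have : CompleteSpace (Matrix n n ℂ) := FiniteDimensional.complete ℂ _
  refine (spectrum.spectralRadius_le_pow_nnnorm_pow_one_div ℂ (M.map (algebraMap ℝ ℂ)) k).trans_lt ?_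
  have hk : (0 : ℝ) < 1 / (k + 1 : ℝ) := by positivity
  rw [← ENNReal.mul_rpow_of_nonneg _ _ hk.le]
  apply ENNReal.rpow_lt_one _ hk
  rw [← ENNReal.coe_mul, ENNReal.coe_lt_one_iff, ← NNReal.coe_lt_one, NNReal.coe_mul, coe_nnnorm,
    coe_nnnorm, norm_map_pow]
  have h1 := norm_map_pow (1 : Matrix n n ℝ) 0
  rw [pow_zero, pow_zero] at h1
  rwa [h1]

end

theorem isStable_of_tendsto_pow {M : Matrix n n ℝ} (h : Tendsto (fun k => M ^ k) atTop (𝓝 0)) :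
    IsStable M := by
  have h1 : Tendsto (fun k => ‖M ^ (k + 1)‖ * ‖(1 : Matrix n n ℝ)‖) atTop (𝓝 0) := by
    simpa using ((h.comp (tendsto_add_atTop_nat 1)).norm.mul_const ‖(1 : Matrix n n ℝ)‖)
  obtain ⟨k, hk⟩ := (h1.eventually_lt_const one_pos).exists
  exact isStable_of_norm_pow_lt hk

/-- Stability holds exactly when some power satisfies a strict norm inequality, so the set is a
union of open sets and continuity of the spectral radius is not needed. -/
theorem isOpen_setOf_isStable : IsOpen {M : Matrix n n ℝ | IsStable M} := by
  have : {M : Matrix n n ℝ | IsStable M} =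
      ⋃ k : ℕ, {M : Matrix n n ℝ | ‖M ^ (k + 1)‖ * ‖(1 : Matrix n n ℝ)‖ < 1} := by
    ext M
    simp only [Set.mem_ofPred_eq, Set.mem_iUnion]
    refine ⟨fun h => ?_, fun ⟨k, hk⟩ => isStable_of_norm_pow_lt hk⟩
    have h1 : Tendsto (fun k => ‖M ^ (k + 1)‖ * ‖(1 : Matrix n n ℝ)‖) atTop (𝓝 0) := by
      simpa using ((h.tendsto_pow.comp (tendsto_add_atTop_nat 1)).norm.mul_const
        ‖(1 : Matrix n n ℝ)‖)
    exact (h1.eventually_lt_const one_pos).exists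
  rw [this]
  refine isOpen_iUnion fun k => isOpen_lt ?_ continuous_const
  fun_prop

theorem IsStable.transpose {M : Matrix n n ℝ} (hM : IsStable M) : IsStable Mᵀ := by
  apply isStable_of_tendsto_pow
  have : Tendsto (fun k => (M ^ k)ᵀ) atTop (𝓝 (0 : Matrix n n ℝ)ᵀ) :=
    ((continuous_id.matrix_transpose).tendsto _).comp hM.tendsto_pow
  simpa [transpose_pow] using this

theorem IsStable.tendsto_conj {M : Matrix n n ℝ} (hM : IsStable M) (S : Matrix n n ℝ) :
    Tendsto (fun k => M ^ k * S * (M ^ k)ᵀ) atTop (𝓝 0) := by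
  have hc : Continuous fun X : Matrix n n ℝ => X * S * Xᵀ := by fun_prop
  have h := (hc.tendsto 0).comp hM.tendsto_pow
  rwa [Matrix.zero_mul, Matrix.zero_mul] at h

end Stability

/-! ### The discrete Lyapunov equation and its solution. -/

section Lyapunov

variable {n : Type*} [Fintype n] [DecidableEq n]

/-- The continuous linear operators on matrices, for the topology of the Frobenius norm. -/
abbrev MatOp (n : Type*) [Fintype n] :=
  @ContinuousLinearMap ℝ ℝ _ _ (RingHom.id ℝ)
    (Matrix n n ℝ) PseudoMetricSpace.toUniformSpace.toTopologicalSpace _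
    (Matrix n n ℝ) PseudoMetricSpace.toUniformSpace.toTopologicalSpace _ _ _

/-- The bilinear map sending `(M, N)` to the linear operator `X ↦ M X Nᵀ`. -/
def conjBilin : Matrix n n ℝ →ₗ[ℝ] Matrix n n ℝ →ₗ[ℝ] MatOp n :=
  LinearMap.mk₂ ℝ
    (fun M N => LinearMap.toContinuousLinearMap
      ((LinearMap.mulRight ℝ Nᵀ).comp (LinearMap.mulLeft ℝ M)))
    (fun _ _ _ => by ext1 X; simp [Matrix.add_mul])
    (fun _ _ _ => by ext1 X; simp)
    (fun _ _ _ => by ext1 X; simp [Matrix.mul_add])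
    (fun _ _ _ => by ext1 X; simp)

@[simp]
theorem conjBilin_apply (M N X : Matrix n n ℝ) : conjBilin M N X = M * X * Nᵀ := rfl

/-- The solution `X` of the discrete Lyapunov equation `X = W + M X Mᵀ`, for stable `M`. -/
def lyap (M W : Matrix n n ℝ) : Matrix n n ℝ :=
  Ring.inverse (1 - conjBilin M M) W

/-- A kernel element satisfies `X = M^k X (M^k)ᵀ` for all `k`, hence vanishes in the limit; in
finite dimension injectivity gives invertibility. -/
theorem IsStable.isUnit_one_sub_conjBilin {M : Matrix n n ℝ} (hM : IsStable M) :
    IsUnit (1 - conjBilin M M : MatOp n) := by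
  have hinj : Function.Injective (1 - conjBilin M M : MatOp n) := by
    rw [injective_iff_map_eq_zero]
    intro X hX
    have h1 : X = M * X * Mᵀ := by
      simpa [sub_eq_zero] using hX
    have h2 : ∀ k : ℕ, X = M ^ k * X * (M ^ k)ᵀ := by
      intro k
      induction k with
      | zero => simp
      | succ k ih =>
        calc X = M ^ k * X * (M ^ k)ᵀ := ih
          _ = M ^ k * (M * X * Mᵀ) * (M ^ k)ᵀ := by rw [← h1]
          _ = _ := by simp only [pow_succ, transpose_mul, Matrix.mul_assoc]
    refine tendsto_nhds_unique ?_ (hM.tendsto_conj X)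
    simp only [← h2]
    exact tendsto_const_nhds
  let e := LinearEquiv.ofInjectiveEndo
    ((1 - conjBilin M M : MatOp n) : Matrix n n ℝ →ₗ[ℝ] Matrix n n ℝ) hinj
  refine ⟨⟨_, (LinearMap.toContinuousLinearMap (e.symm : Matrix n n ℝ →ₗ[ℝ] Matrix n n ℝ) : MatOp n), ?_, ?_⟩, rfl⟩
  · ext1 X
    exact e.apply_symm_apply X
  · ext1 X
    exact e.symm_apply_apply X

theorem IsStable.lyap_eq {M : Matrix n n ℝ} (hM : IsStable M) (W : Matrix n n ℝ) :
    lyap M W = W + M * lyap M W * Mᵀ := by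
  have h := congrArg (fun f : MatOp n => f W)
    (Ring.mul_inverse_cancel _ hM.isUnit_one_sub_conjBilin)
  change lyap M W - M * lyap M W * Mᵀ = W at h
  exact sub_eq_iff_eq_add.1 h

theorem IsStable.lyap_eq_sum_add {M : Matrix n n ℝ} (hM : IsStable M) (W : Matrix n n ℝ) (t : ℕ) :
    lyap M W = ∑ s ∈ Finset.range t, M ^ s * W * (M ^ s)ᵀ
      + M ^ t * lyap M W * (M ^ t)ᵀ := by
  induction t with
  | zero => simp
  | succ t ih =>
    conv_lhs => rw [ih]
    conv_lhs => enter [2]; rw [hM.lyap_eq W]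
    simp only [Finset.sum_range_succ, pow_succ, transpose_mul, Matrix.mul_assoc, Matrix.mul_add,
      Matrix.add_mul, add_assoc]

/-- The solution is the limit of the semidefinite partial sums `∑ M^s W (M^s)ᵀ`. -/
theorem IsStable.lyap_posSemidef {M W : Matrix n n ℝ} (hM : IsStable M) (hW : W.PosSemidef) :
    (lyap M W).PosSemidef := by
  have hlim : Tendsto (fun t => ∑ s ∈ Finset.range t, M ^ s * W * (M ^ s)ᵀ) atTop
      (𝓝 (lyap M W)) := by
    have := (tendsto_const_nhds (x := lyap M W)).sub (hM.tendsto_conj (lyap M W))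
    rw [sub_zero] at this
    refine this.congr fun t => ?_
    rw [sub_eq_iff_eq_add]
    exact hM.lyap_eq_sum_add W t
  have hP : ∀ t, (∑ s ∈ Finset.range t, M ^ s * W * (M ^ s)ᵀ).PosSemidef := fun t =>
    posSemidef_sum _ fun s _ => posSemidef_mul_mul_transpose hW _
  refine PosSemidef.of_dotProduct_mulVec_nonneg ?_ fun x => ?_
  · have h1 := ((continuous_id.matrix_transpose).tendsto (lyap M W)).comp hlim
    rw [IsHermitian, conjTranspose_eq_transpose_of_trivial]
    refine tendsto_nhds_unique h1 (hlim.congr fun t => ?_)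
    have := (hP t).1
    rw [IsHermitian, conjTranspose_eq_transpose_of_trivial] at this
    exact this.symm
  · have hc : Continuous fun X : Matrix n n ℝ => star x ⬝ᵥ X *ᵥ x := by fun_prop
    exact ge_of_tendsto' ((hc.tendsto _).comp hlim) fun t => (hP t).dotProduct_mulVec_nonneg x

/-- This bounds all powers of `M` at once by one trace, which is how a cost bound later yields
stability of limits. -/
theorem IsStable.mul_sum_norm_sq_le_trace_lyap {M W : Matrix n n ℝ} (hM : IsStable M)
    (hW : W.PosSemidef) {c : ℝ} (hc : (W - c • (1 : Matrix n n ℝ)).PosSemidef) (t : ℕ) :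
    c * ∑ s ∈ Finset.range t, ‖M ^ s‖ ^ 2 ≤ trace (lyap M W) := by
  rw [hM.lyap_eq_sum_add W t, trace_add, trace_sum, Finset.mul_sum]
  have h1 := (posSemidef_mul_mul_transpose (hM.lyap_posSemidef hW) (M ^ t)).trace_nonneg
  have h2 : ∑ s ∈ Finset.range t, c * ‖M ^ s‖ ^ 2 ≤
      ∑ s ∈ Finset.range t, trace (M ^ s * W * (M ^ s)ᵀ) :=
    Finset.sum_le_sum fun s _ => mul_norm_sq_le_trace hc (M ^ s)
  linarith

theorem IsStable.lyap_sub_smul_one_posSemidef {M W : Matrix n n ℝ} (hM : IsStable M)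
    (hW : W.PosSemidef) {c : ℝ} (hc : (W - c • (1 : Matrix n n ℝ)).PosSemidef) :
    (lyap M W - c • (1 : Matrix n n ℝ)).PosSemidef := by
  have h := hc.add (posSemidef_mul_mul_transpose (hM.lyap_posSemidef hW) M)
  convert! h using 1
  conv_lhs => rw [hM.lyap_eq W]
  abel

/-- Duality between the Lyapunov equation of `M` and that of `Mᵀ`. -/
theorem IsStable.trace_lyap_mul_sub {M : Matrix n n ℝ} (hM : IsStable M) (W P : Matrix n n ℝ) :
    trace (lyap M W * (P - Mᵀ * P * M)) = trace (W * P) := by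
  have h : W = lyap M W - M * lyap M W * Mᵀ := eq_sub_of_add_eq (hM.lyap_eq W).symm
  conv_rhs => rw [h]
  rw [Matrix.mul_sub, Matrix.sub_mul, trace_sub, trace_sub]
  congr 1
  rw [← Matrix.mul_assoc, trace_mul_comm]
  simp only [Matrix.mul_assoc]

/-- Inversion is smooth at units of the operator algebra, and the operator depends quadratically on
`M`. -/
theorem contDiffAt_lyap {M : Matrix n n ℝ} (hM : IsStable M) (W : Matrix n n ℝ) {r : WithTop ℕ∞} :
    ContDiffAt ℝ r (fun M => lyap M W) M := by
  have : CompleteSpace (MatOp n) := FiniteDimensional.complete ℝ _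
  have h1 : ContDiff ℝ r fun M : Matrix n n ℝ =>
      (1 - conjBilin M M : MatOp n) := by
    refine contDiff_const.sub ?_
    exact ((conjBilin (n := n)).toContinuousBilinearMap.contDiff).clm_apply contDiff_id
  obtain ⟨u, hu⟩ := hM.isUnit_one_sub_conjBilin
  have h2 := contDiffAt_ringInverse (n := r) ℝ u
  rw [hu] at h2
  exact (ContDiffAt.comp M h2 h1.contDiffAt).clm_apply contDiffAt_const

end Lyapunov

/-! ### First and second moments of the Gaussian laws, the noise and the state. -/

section GaussianMoments

variable {d : ℕ} {S : Matrix (Fin d) (Fin d) ℝ}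

theorem memLp_eval_multivariateGaussian (a : Fin d) :
    MemLp (fun x : EuclideanSpace ℝ (Fin d) => x a) 2 (multivariateGaussian 0 S) := by
  have h := (EuclideanSpace.proj a : EuclideanSpace ℝ (Fin d) →L[ℝ] ℝ).comp_memLp'
    (IsGaussian.memLp_two_id (μ := multivariateGaussian (0 : EuclideanSpace ℝ (Fin d)) S))
  exact h

theorem integral_eval_multivariateGaussian (a : Fin d) :
    ∫ x, x a ∂(multivariateGaussian (0 : EuclideanSpace ℝ (Fin d)) S) = 0 := by
  have h := IsGaussian.integral_dual (μ := multivariateGaussian (0 : EuclideanSpace ℝ (Fin d)) S)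
    (EuclideanSpace.proj a : EuclideanSpace ℝ (Fin d) →L[ℝ] ℝ)
  simpa using h

theorem integral_eval_mul_eval_multivariateGaussian (hS : S.PosSemidef) (a b : Fin d) :
    ∫ x, x a * x b ∂(multivariateGaussian (0 : EuclideanSpace ℝ (Fin d)) S) = S a b := by
  rw [← covariance_eval_multivariateGaussian (μ := 0) hS a b,
    covariance_eq_sub (memLp_eval_multivariateGaussian a) (memLp_eval_multivariateGaussian b),
    integral_eval_multivariateGaussian]
  simp

end GaussianMoments

namespace LQRSystem

section NoiseMoments

variable {d k : ℕ} (s : LQRSystem d k) (S₀ : Matrix (Fin d) (Fin d) ℝ)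

instance : IsProbabilityMeasure (s.noiseLaw S₀) := by
  unfold noiseLaw
  infer_instance

theorem measurePreserving_fst_noiseLaw :
    MeasurePreserving (fun z : EuclideanSpace ℝ (Fin d) × (ℕ → EuclideanSpace ℝ (Fin d)) => z.1)
      (s.noiseLaw S₀) (multivariateGaussian 0 S₀) :=
  measurePreserving_fst

theorem measurePreserving_fst_eval_noiseLaw (n : ℕ) :
    MeasurePreserving
      (fun z : EuclideanSpace ℝ (Fin d) × (ℕ → EuclideanSpace ℝ (Fin d)) => (z.1, z.2 n))
      (s.noiseLaw S₀) ((multivariateGaussian 0 S₀).prod (multivariateGaussian 0 s.Ψ)) :=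
  (MeasurePreserving.id _).prod
    (measurePreserving_eval_infinitePi (fun _ : ℕ => multivariateGaussian 0 s.Ψ) n)

theorem measurePreserving_eval_noiseLaw (n : ℕ) :
    MeasurePreserving (fun z : EuclideanSpace ℝ (Fin d) × (ℕ → EuclideanSpace ℝ (Fin d)) => z.2 n)
      (s.noiseLaw S₀) (multivariateGaussian 0 s.Ψ) :=
  measurePreserving_snd.comp (s.measurePreserving_fst_eval_noiseLaw S₀ n)

theorem measurePreserving_eval_eval_noiseLaw {m n : ℕ} (h : m ≠ n) :
    MeasurePreserving
      (fun z : EuclideanSpace ℝ (Fin d) × (ℕ → EuclideanSpace ℝ (Fin d)) => (z.2 m, z.2 n))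
      (s.noiseLaw S₀) ((multivariateGaussian 0 s.Ψ).prod (multivariateGaussian 0 s.Ψ)) := by
  have h1 : MeasurePreserving (fun w : ℕ → EuclideanSpace ℝ (Fin d) => (w m, w n))
      (Measure.infinitePi fun _ : ℕ => multivariateGaussian 0 s.Ψ)
      ((multivariateGaussian 0 s.Ψ).prod (multivariateGaussian 0 s.Ψ)) :=
    ⟨by fun_prop, Measure.infinitePi_map_eval_prod h⟩
  exact h1.comp measurePreserving_snd

theorem memLp_fst (a : Fin d) :
    MemLp (fun z : EuclideanSpace ℝ (Fin d) × (ℕ → EuclideanSpace ℝ (Fin d)) => z.1 a) 2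
      (s.noiseLaw S₀) :=
  (memLp_eval_multivariateGaussian a).comp_measurePreserving (s.measurePreserving_fst_noiseLaw S₀)

theorem memLp_noise (n : ℕ) (a : Fin d) :
    MemLp (fun z : EuclideanSpace ℝ (Fin d) × (ℕ → EuclideanSpace ℝ (Fin d)) => z.2 n a) 2
      (s.noiseLaw S₀) :=
  (memLp_eval_multivariateGaussian a).comp_measurePreserving
    (s.measurePreserving_eval_noiseLaw S₀ n)

variable {S₀}

theorem integral_fst_mul_fst (hS₀ : S₀.PosSemidef) (a b : Fin d) :
    ∫ z, z.1 a * z.1 b ∂(s.noiseLaw S₀) = S₀ a b := by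
  have hp := s.measurePreserving_fst_noiseLaw S₀
  rw [← integral_eval_mul_eval_multivariateGaussian hS₀ a b, ← hp.map_eq,
    integral_map hp.aemeasurable (by fun_prop)]

theorem integral_fst_mul_noise (n : ℕ) (a b : Fin d) :
    ∫ z, z.1 a * z.2 n b ∂(s.noiseLaw S₀) = 0 := by
  have hp := s.measurePreserving_fst_eval_noiseLaw S₀ n
  have h1 := integral_map (μ := s.noiseLaw S₀) hp.aemeasurable
    (f := fun y : EuclideanSpace ℝ (Fin d) × EuclideanSpace ℝ (Fin d) => y.1 a * y.2 b)
    (by fun_prop)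
  rw [← h1, hp.map_eq, integral_prod_mul (fun x : EuclideanSpace ℝ (Fin d) => x a)
    (fun x : EuclideanSpace ℝ (Fin d) => x b), integral_eval_multivariateGaussian, zero_mul]

theorem integral_noise_mul_noise_self (n : ℕ) (a b : Fin d) :
    ∫ z, z.2 n a * z.2 n b ∂(s.noiseLaw S₀) = s.Ψ a b := by
  have hp := s.measurePreserving_eval_noiseLaw S₀ n
  rw [← integral_eval_mul_eval_multivariateGaussian s.hΨ.posSemidef a b, ← hp.map_eq,
    integral_map hp.aemeasurable (by fun_prop)]

theorem integral_noise_mul_noise_of_ne {m n : ℕ} (h : m ≠ n) (a b : Fin d) :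
    ∫ z, z.2 m a * z.2 n b ∂(s.noiseLaw S₀) = 0 := by
  have hp := s.measurePreserving_eval_eval_noiseLaw S₀ h
  have h1 := integral_map (μ := s.noiseLaw S₀) hp.aemeasurable
    (f := fun y : EuclideanSpace ℝ (Fin d) × EuclideanSpace ℝ (Fin d) => y.1 a * y.2 b)
    (by fun_prop)
  rw [← h1, hp.map_eq, integral_prod_mul (fun x : EuclideanSpace ℝ (Fin d) => x a)
    (fun x : EuclideanSpace ℝ (Fin d) => x b), integral_eval_multivariateGaussian, zero_mul]

end NoiseMoments

/-! ### The ergodic cost as a trace against the stationary covariance. -/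

section Cost

variable {d k : ℕ} (s : LQRSystem d k) (S₀ : Matrix (Fin d) (Fin d) ℝ)
  (K : Matrix (Fin k) (Fin d) ℝ)

/-- The state at time `t` as a random vector on the noise space. -/
def stateVar (t : ℕ) (z : EuclideanSpace ℝ (Fin d) × (ℕ → EuclideanSpace ℝ (Fin d))) :
    Fin d → ℝ :=
  s.state K z.1.ofLp (fun n => (z.2 n).ofLp) t

theorem stateVar_succ (t : ℕ) (z : EuclideanSpace ℝ (Fin d) × (ℕ → EuclideanSpace ℝ (Fin d)))
    (a : Fin d) :
    s.stateVar K (t + 1) z a =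
      ∑ c, (s.A - s.B * K) a c * s.stateVar K t z c + z.2 t a := by
  have h : s.stateVar K (t + 1) z =
      (s.A - s.B * K) *ᵥ s.stateVar K t z + (z.2 t).ofLp := by
    change s.A *ᵥ s.stateVar K t z + s.B *ᵥ control K (s.stateVar K t z) + (z.2 t).ofLp = _
    rw [control, Matrix.mulVec_neg, Matrix.mulVec_mulVec, Matrix.sub_mulVec, sub_eq_add_neg]
  rw [h]
  rfl

theorem memLp_stateVar (t : ℕ) (a : Fin d) :
    MemLp (fun z => s.stateVar K t z a) 2 (s.noiseLaw S₀) := by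
  induction t generalizing a with
  | zero => exact s.memLp_fst S₀ a
  | succ t ih =>
    simp only [stateVar_succ]
    exact (memLp_finsetSum _ fun c _ => (ih c).const_mul _).add (s.memLp_noise S₀ t a)

variable {S₀}

/-- The state at time `t` involves only `x₀` and the noise before `t`, hence is uncorrelated with
`w_n` for `n ≥ t`. -/
theorem integral_stateVar_mul_noise (t n : ℕ) (h : t ≤ n) (a b : Fin d) :
    ∫ z, s.stateVar K t z a * z.2 n b ∂(s.noiseLaw S₀) = 0 := by
  induction t generalizing a with
  | zero => exact s.integral_fst_mul_noise n a b
  | succ t ih =>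
    simp only [stateVar_succ, add_mul, Finset.sum_mul, mul_assoc]
    have hi : ∀ c, Integrable (fun z => s.stateVar K t z c * z.2 n b) (s.noiseLaw S₀) := fun c =>
      (s.memLp_stateVar S₀ K t c).integrable_mul (s.memLp_noise S₀ n b)
    have hj : Integrable (fun z => z.2 t a * z.2 n b) (s.noiseLaw S₀) :=
      (s.memLp_noise S₀ t a).integrable_mul (s.memLp_noise S₀ n b)
    rw [integral_add (integrable_finsetSum _ fun c _ => (hi c).const_mul _) hj,
      integral_finsetSum _ fun c _ => (hi c).const_mul _,
      s.integral_noise_mul_noise_of_ne (by omega)]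
    simp [integral_const_mul, ih (by omega)]

/-- The second moment matrix of the state at time `t`. -/
def secondMoment (S₀ M W : Matrix (Fin d) (Fin d) ℝ) : ℕ → Matrix (Fin d) (Fin d) ℝ
  | 0 => S₀
  | t + 1 => M * secondMoment S₀ M W t * Mᵀ + W

theorem integral_stateVar_mul_stateVar (hS₀ : S₀.PosSemidef) (t : ℕ) (a b : Fin d) :
    ∫ z, s.stateVar K t z a * s.stateVar K t z b ∂(s.noiseLaw S₀) =
      secondMoment S₀ (s.A - s.B * K) s.Ψ t a b := by
  induction t generalizing a b with
  | zero => exact s.integral_fst_mul_fst hS₀ a b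
  | succ t ih =>
    set M := s.A - s.B * K with hM
    have hx := s.memLp_stateVar S₀ K t
    have hw := s.memLp_noise S₀ t
    have e : ∀ z : EuclideanSpace ℝ (Fin d) × (ℕ → EuclideanSpace ℝ (Fin d)),
        s.stateVar K (t + 1) z a * s.stateVar K (t + 1) z b =
        (∑ c, ∑ e, M a c * M b e * (s.stateVar K t z c * s.stateVar K t z e)
          + ∑ c, M a c * (s.stateVar K t z c * z.2 t b))
        + (∑ c, M b c * (s.stateVar K t z c * z.2 t a) + z.2 t a * z.2 t b) := by
      intro z
      rw [stateVar_succ, stateVar_succ, ← hM, add_mul, mul_add, mul_add, Finset.sum_mul_sum,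
        Finset.sum_mul, Finset.mul_sum]
      congr 2
      · exact Finset.sum_congr rfl fun c _ => Finset.sum_congr rfl fun e _ => by ring
      · exact Finset.sum_congr rfl fun c _ => by ring
      · exact Finset.sum_congr rfl fun c _ => by ring
    have i1 : ∀ c e, Integrable (fun z => M a c * M b e *
        (s.stateVar K t z c * s.stateVar K t z e)) (s.noiseLaw S₀) := fun c e =>
      ((hx c).integrable_mul (hx e)).const_mul _
    have i2 : ∀ a b c, Integrable (fun z => M a c * (s.stateVar K t z c * z.2 t b))
        (s.noiseLaw S₀) := fun a b c =>
      ((hx c).integrable_mul (hw b)).const_mul _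
    have j1 := integrable_finsetSum Finset.univ fun c _ =>
      integrable_finsetSum Finset.univ fun e _ => i1 c e
    have j2 := fun a b => integrable_finsetSum Finset.univ fun c _ => i2 a b c
    have j3 : Integrable (fun z => z.2 t a * z.2 t b) (s.noiseLaw S₀) :=
      (hw a).integrable_mul (hw b)
    simp only [e]
    rw [integral_add (by exact j1.add (j2 a b)) (by exact (j2 b a).add j3),
      integral_add j1 (j2 a b),
      integral_add (j2 b a) j3, integral_finsetSum _ fun c _ =>
      integrable_finsetSum Finset.univ fun e _ => i1 c e,
      integral_finsetSum _ fun c _ => i2 a b c, integral_finsetSum _ fun c _ => i2 b a c,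
      s.integral_noise_mul_noise_self]
    have h3 : ∀ c, ∫ z, ∑ e, M a c * M b e * (s.stateVar K t z c * s.stateVar K t z e)
        ∂(s.noiseLaw S₀) = ∑ e, M a c * M b e * secondMoment S₀ M s.Ψ t c e := by
      intro c
      rw [integral_finsetSum _ fun e _ => i1 c e]
      simp only [integral_const_mul, ih]
    simp only [h3, integral_const_mul, s.integral_stateVar_mul_noise K t t le_rfl, mul_zero,
      Finset.sum_const_zero, add_zero, zero_add]
    simp only [secondMoment, Matrix.add_apply, Matrix.mul_apply, Matrix.transpose_apply, Finset.sum_mul]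
    rw [Finset.sum_comm]
    congr 1
    exact Finset.sum_congr rfl fun c _ => Finset.sum_congr rfl fun e _ => by ring

theorem stageCost_control (x : Fin d → ℝ) :
    s.stageCost x (control K x) = ∑ a, ∑ b, (s.Q + Kᵀ * s.R * K) a b * (x a * x b) := by
  have h : s.stageCost x (control K x) = x ⬝ᵥ (s.Q + Kᵀ * s.R * K) *ᵥ x := by
    rw [stageCost, control, Matrix.mulVec_neg, neg_dotProduct_neg, Matrix.add_mulVec,
      dotProduct_add, ← Matrix.mulVec_mulVec, ← Matrix.mulVec_mulVec, dotProduct_mulVec x Kᵀ,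
      vecMul_transpose]
  rw [h]
  simp only [dotProduct, mulVec, Finset.mul_sum]
  exact Finset.sum_congr rfl fun c _ => Finset.sum_congr rfl fun e _ => by ring

theorem expectedCost_eq (hS₀ : S₀.PosSemidef) (T : ℕ) :
    s.expectedCost S₀ K T = ∑ t ∈ Finset.range T,
      trace (secondMoment S₀ (s.A - s.B * K) s.Ψ t * (s.Q + Kᵀ * s.R * K)) := by
  have i1 : ∀ t a b, Integrable (fun z => (s.Q + Kᵀ * s.R * K) a b *
      (s.stateVar K t z a * s.stateVar K t z b)) (s.noiseLaw S₀) := fun t a b =>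
    ((s.memLp_stateVar S₀ K t a).integrable_mul (s.memLp_stateVar S₀ K t b)).const_mul _
  have hsymm : (s.Q + Kᵀ * s.R * K)ᵀ = s.Q + Kᵀ * s.R * K := by
    have hQ : s.Qᵀ = s.Q := s.hQ.1
    have hR : s.Rᵀ = s.R := s.hR.1
    simp [transpose_mul, hQ, hR, Matrix.mul_assoc]
  have e : s.expectedCost S₀ K T = ∫ z, ∑ t ∈ Finset.range T, ∑ a, ∑ b,
      (s.Q + Kᵀ * s.R * K) a b * (s.stateVar K t z a * s.stateVar K t z b) ∂(s.noiseLaw S₀) := by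
    unfold expectedCost
    simp only [stageCost_control]
    rfl
  rw [e, integral_finsetSum _ fun t _ => integrable_finsetSum Finset.univ fun a _ =>
    integrable_finsetSum Finset.univ fun b _ => i1 t a b]
  refine Finset.sum_congr rfl fun t _ => ?_
  rw [integral_finsetSum _ fun a _ => integrable_finsetSum Finset.univ fun b _ => i1 t a b,
    trace_mul_comm, ← hsymm, trace_transpose_mul_eq_sum]
  refine Finset.sum_congr rfl fun a _ => ?_
  rw [hsymm, integral_finsetSum _ fun b _ => i1 t a b]
  simp only [integral_const_mul, s.integral_stateVar_mul_stateVar K hS₀]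

/-- `lyap M W` is the fixed point of the moment recursion, and each step conjugates the deviation
from it by `M`. -/
theorem secondMoment_eq {M W : Matrix (Fin d) (Fin d) ℝ} (hM : IsStable M) (t : ℕ) :
    secondMoment S₀ M W t = lyap M W + M ^ t * (S₀ - lyap M W) * (M ^ t)ᵀ := by
  induction t with
  | zero => simp [secondMoment]
  | succ t ih =>
    rw [secondMoment, ih, Matrix.mul_add, Matrix.add_mul]
    have h := hM.lyap_eq W
    have h2 : M * (M ^ t * (S₀ - lyap M W) * (M ^ t)ᵀ) * Mᵀ =
        M ^ (t + 1) * (S₀ - lyap M W) * (M ^ (t + 1))ᵀ := by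
      rw [pow_succ', transpose_mul]
      simp only [Matrix.mul_assoc]
    rw [h2, add_right_comm, add_comm _ W, ← h]

variable {K}

/-- The ergodic cost of a stable gain in terms of the stationary state covariance. -/
theorem cost_eq (hS₀ : S₀.PosSemidef) (hK : K ∈ s.stableSet) :
    s.cost S₀ K = trace (lyap (s.A - s.B * K) s.Ψ * (s.Q + Kᵀ * s.R * K)) := by
  have hM : IsStable (s.A - s.B * K) := hK
  set M := s.A - s.B * K with hMdef
  have h1 : Tendsto (secondMoment S₀ M s.Ψ) atTop (𝓝 (lyap M s.Ψ)) := by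
    have := (tendsto_const_nhds (x := lyap M s.Ψ)).add (hM.tendsto_conj (S₀ - lyap M s.Ψ))
    rw [add_zero] at this
    exact this.congr fun t => (secondMoment_eq hM t).symm
  have hc : Continuous fun X : Matrix (Fin d) (Fin d) ℝ => trace (X * (s.Q + Kᵀ * s.R * K)) := by
    fun_prop
  -- The expected stage costs converge, so their time averages have the same limit.
  have h2 := ((hc.tendsto _).comp h1).cesaro
  refine Tendsto.limUnder_eq (h2.congr fun T => ?_)
  rw [s.expectedCost_eq K hS₀ T, one_div]
  rfl

end Cost

end LQRSystem

/-! ### Smoothness of matrix operations and the Frobenius gradient. -/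

section Smoothness

variable {l m n : Type*} [Fintype l] [Fintype m] [Fintype n]

theorem isBoundedBilinearMap_matrix_mul :
    IsBoundedBilinearMap ℝ fun p : Matrix l m ℝ × Matrix m n ℝ => p.1 * p.2 where
  add_left _ _ _ := Matrix.add_mul _ _ _
  smul_left _ _ _ := Matrix.smul_mul _ _ _
  add_right _ _ _ := Matrix.mul_add _ _ _
  smul_right _ _ _ := Matrix.mul_smul _ _ _
  bound := ⟨1, one_pos, fun X Y => by simpa using Matrix.frobenius_norm_mul X Y⟩

theorem isBoundedLinearMap_matrix_transpose :
    IsBoundedLinearMap ℝ fun X : Matrix m n ℝ => Xᵀ :=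
  IsLinearMap.with_bound ⟨fun _ _ => rfl, fun _ _ => rfl⟩ 1 fun X => by simp

theorem isBoundedLinearMap_matrix_trace :
    IsBoundedLinearMap ℝ fun X : Matrix n n ℝ => trace X := by
  classical
  refine IsLinearMap.with_bound ⟨trace_add, fun c X => trace_smul c X⟩ ‖(1 : Matrix n n ℝ)‖
    fun X => ?_
  simpa [mul_comm] using abs_trace_mul_le X 1

variable {E : Type*} [NormedAddCommGroup E] [NormedSpace ℝ E] {x : E} {r : WithTop ℕ∞}

theorem _root_.ContDiffAt.matrix_mul {f : E → Matrix l m ℝ} {g : E → Matrix m n ℝ}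
    (hf : ContDiffAt ℝ r f x) (hg : ContDiffAt ℝ r g x) :
    ContDiffAt ℝ r (fun y => f y * g y) x :=
  isBoundedBilinearMap_matrix_mul.contDiff.contDiffAt.comp x (hf.prodMk hg)

theorem _root_.ContDiffAt.matrix_transpose {f : E → Matrix m n ℝ} (hf : ContDiffAt ℝ r f x) :
    ContDiffAt ℝ r (fun y => (f y)ᵀ) x :=
  isBoundedLinearMap_matrix_transpose.contDiff.contDiffAt.comp x hf

theorem _root_.ContDiffAt.matrix_trace {f : E → Matrix n n ℝ} (hf : ContDiffAt ℝ r f x) :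
    ContDiffAt ℝ r (fun y => trace (f y)) x :=
  isBoundedLinearMap_matrix_trace.contDiff.contDiffAt.comp x hf

end Smoothness

section Gradient

variable {k d : ℕ} {f : Matrix (Fin k) (Fin d) ℝ → ℝ} {K : Matrix (Fin k) (Fin d) ℝ}

theorem matGradient_apply (a : Fin k) (b : Fin d) :
    matGradient f K a b = fderiv ℝ f K (Matrix.single a b 1) := rfl

theorem fderiv_eq_trace_matGradient (H : Matrix (Fin k) (Fin d) ℝ) :
    fderiv ℝ f K H = trace ((matGradient f K)ᵀ * H) := by
  rw [trace_transpose_mul_eq_sum]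
  conv_lhs => rw [matrix_eq_sum_single H]
  simp only [map_sum, matGradient_apply]
  refine Finset.sum_congr rfl fun a _ => Finset.sum_congr rfl fun b _ => ?_
  have : single a b (H a b) = H a b • single a b (1 : ℝ) := by simp
  rw [this, map_smul, smul_eq_mul, mul_comm]

theorem contDiffAt_matGradient {r r' : WithTop ℕ∞} (hf : ContDiffAt ℝ r' f K) (h : r + 1 ≤ r') :
    ContDiffAt ℝ r (matGradient f) K := by
  have h1 : matGradient f = fun K => ∑ a, ∑ b, fderiv ℝ f K (single a b 1) • single a b (1 : ℝ) := by
    ext1 K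
    conv_lhs => rw [matrix_eq_sum_single (matGradient f K)]
    simp only [matGradient_apply, smul_single, smul_eq_mul, mul_one]
  rw [h1]
  refine ContDiffAt.sum fun a _ => ContDiffAt.sum fun b _ => ContDiffAt.fun_smul ?_ contDiffAt_const
  exact (hf.fderiv_right h).clm_apply contDiffAt_const

end Gradient

/-! ### Coercivity, cost differences and gradient dominance for one system. -/

namespace LQRSystem

variable {d k : ℕ} (s : LQRSystem d k) {S₀ : Matrix (Fin d) (Fin d) ℝ}
  {K K' : Matrix (Fin k) (Fin d) ℝ}

theorem continuous_closedLoop : Continuous fun K : Matrix (Fin k) (Fin d) ℝ => s.A - s.B * K := by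
  fun_prop

theorem isOpen_stableSet : IsOpen s.stableSet :=
  isOpen_setOf_isStable.preimage s.continuous_closedLoop

theorem contDiffAt_stationaryCovariance (hK : K ∈ s.stableSet) {r : WithTop ℕ∞} :
    ContDiffAt ℝ r (fun K => lyap (s.A - s.B * K) s.Ψ) K :=
  ContDiffAt.comp K (contDiffAt_lyap hK s.Ψ)
    (contDiffAt_const.sub (contDiffAt_const.matrix_mul contDiffAt_id))

theorem contDiffAt_cost (hS₀ : S₀.PosSemidef) (hK : K ∈ s.stableSet) {r : WithTop ℕ∞} :
    ContDiffAt ℝ r (s.cost S₀) K := by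
  have hev : s.cost S₀ =ᶠ[𝓝 K] fun K =>
      trace (lyap (s.A - s.B * K) s.Ψ * (s.Q + Kᵀ * s.R * K)) := by
    filter_upwards [s.isOpen_stableSet.mem_nhds hK] with K' hK'
    exact s.cost_eq hS₀ hK'
  refine ContDiffAt.congr_of_eventuallyEq ?_ hev
  exact ((s.contDiffAt_stationaryCovariance hK).matrix_mul (contDiffAt_const.add
    ((contDiffAt_id.matrix_transpose.matrix_mul contDiffAt_const).matrix_mul
      contDiffAt_id))).matrix_trace

theorem stageCost_posSemidef (K : Matrix (Fin k) (Fin d) ℝ) :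
    (s.Q + Kᵀ * s.R * K).PosSemidef :=
  s.hQ.posSemidef.add (posSemidef_transpose_mul_mul s.hR.posSemidef K)

theorem cost_nonneg (hS₀ : S₀.PosSemidef) (hK : K ∈ s.stableSet) : 0 ≤ s.cost S₀ K := by
  rw [s.cost_eq hS₀ hK]
  exact trace_mul_nonneg (IsStable.lyap_posSemidef hK s.hΨ.posSemidef) (s.stageCost_posSemidef K)

/-- Positive lower bounds on `Q` and `Ψ` give cost at least `q tr Σ_K`, and `tr Σ_K` dominates the
sum of squared powers. -/
theorem exists_mul_sum_norm_sq_le_cost (hS₀ : S₀.PosSemidef) :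
    ∃ c : ℝ, 0 < c ∧ ∀ K ∈ s.stableSet, ∀ t : ℕ,
      c * ∑ j ∈ Finset.range t, ‖(s.A - s.B * K) ^ j‖ ^ 2 ≤ s.cost S₀ K := by
  obtain ⟨q, hq, hqQ⟩ := exists_pos_sub_smul_one_posSemidef s.hQ
  obtain ⟨c, hc, hcΨ⟩ := exists_pos_sub_smul_one_posSemidef s.hΨ
  refine ⟨q * c, by positivity, fun K hK t => ?_⟩
  have hS := IsStable.lyap_posSemidef hK s.hΨ.posSemidef
  have h1 := IsStable.mul_sum_norm_sq_le_trace_lyap hK s.hΨ.posSemidef hcΨ t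
  have h2 := mul_trace_le_trace_mul hqQ hS
  have h3 := trace_mul_nonneg hS (posSemidef_transpose_mul_mul s.hR.posSemidef K)
  rw [s.cost_eq hS₀ hK, Matrix.mul_add, trace_add, mul_assoc]
  have h4 := mul_le_mul_of_nonneg_left h1 hq.le
  linarith

/-- Here the control cost is used: `Σ_K ≥ c` because one step of noise already contributes `Ψ`, and
`R ≥ q`. -/
theorem exists_mul_norm_sq_le_cost (hS₀ : S₀.PosSemidef) :
    ∃ c : ℝ, 0 < c ∧ ∀ K ∈ s.stableSet, c * ‖K‖ ^ 2 ≤ s.cost S₀ K := by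
  obtain ⟨q, hq, hqR⟩ := exists_pos_sub_smul_one_posSemidef s.hR
  obtain ⟨c, hc, hcΨ⟩ := exists_pos_sub_smul_one_posSemidef s.hΨ
  refine ⟨q * c, by positivity, fun K hK => ?_⟩
  have hS := IsStable.lyap_posSemidef hK s.hΨ.posSemidef
  have h1 := mul_norm_sq_le_trace (IsStable.lyap_sub_smul_one_posSemidef hK s.hΨ.posSemidef hcΨ) K
  have h2 := mul_trace_le_trace_mul hqR (posSemidef_mul_mul_transpose hS K)
  have h3 := trace_mul_nonneg hS s.hQ.posSemidef
  have h5 : trace (K * lyap (s.A - s.B * K) s.Ψ * Kᵀ * s.R) =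
      trace (lyap (s.A - s.B * K) s.Ψ * (Kᵀ * s.R * K)) := by
    rw [Matrix.mul_assoc, Matrix.mul_assoc, trace_mul_comm]
    simp only [Matrix.mul_assoc]
  rw [s.cost_eq hS₀ hK, Matrix.mul_add, trace_add, mul_assoc, ← h5]
  have h4 := mul_le_mul_of_nonneg_left h1 hq.le
  linarith

/-- Gains that are limits of stable gains of bounded cost are stable. -/
theorem mem_stableSet_of_tendsto (hS₀ : S₀.PosSemidef) {u : ℕ → Matrix (Fin k) (Fin d) ℝ}
    (hu : ∀ n, u n ∈ s.stableSet) {C : ℝ} (hC : ∀ n, s.cost S₀ (u n) ≤ C)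
    (hlim : Tendsto u atTop (𝓝 K)) : K ∈ s.stableSet := by
  obtain ⟨c, hc, hle⟩ := s.exists_mul_sum_norm_sq_le_cost hS₀
  -- For fixed `t` the finite sum is continuous in the gain, so the uniform bound passes to the
  -- limit `K` before `t` grows.
  have hbound : ∀ t : ℕ, ∑ j ∈ Finset.range t, ‖(s.A - s.B * K) ^ j‖ ^ 2 ≤ C / c := by
    intro t
    have hcont : Continuous fun K : Matrix (Fin k) (Fin d) ℝ =>
        ∑ j ∈ Finset.range t, ‖(s.A - s.B * K) ^ j‖ ^ 2 := by fun_prop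
    refine le_of_tendsto' ((hcont.tendsto K).comp hlim) fun n => ?_
    rw [le_div_iff₀ hc, mul_comm]
    exact (hle _ (hu n) t).trans (hC n)
  have hsum : Summable fun j : ℕ => ‖(s.A - s.B * K) ^ j‖ ^ 2 :=
    summable_of_sum_range_le (fun j => sq_nonneg _) hbound
  apply isStable_of_tendsto_pow
  refine squeeze_zero_norm (a := fun j => √(‖(s.A - s.B * K) ^ j‖ ^ 2)) (fun j => ?_) ?_
  · rw [Real.sqrt_sq (norm_nonneg _)]
  · simpa only [Real.sqrt_zero] using hsum.tendsto_atTop_zero.sqrt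

/-- The value matrix of the gain `K`. -/
def valueMatrix (K : Matrix (Fin k) (Fin d) ℝ) : Matrix (Fin d) (Fin d) ℝ :=
  lyap (s.A - s.B * K)ᵀ (s.Q + Kᵀ * s.R * K)

/-- The matrix `E` for which the gradient of the cost is twice `E` times the stationary
covariance. -/
def advantageMatrix (K : Matrix (Fin k) (Fin d) ℝ) : Matrix (Fin k) (Fin d) ℝ :=
  s.R * K - s.Bᵀ * s.valueMatrix K * (s.A - s.B * K)

theorem valueMatrix_posSemidef (hK : K ∈ s.stableSet) : (s.valueMatrix K).PosSemidef :=
  (IsStable.transpose hK).lyap_posSemidef (s.stageCost_posSemidef K)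

theorem trace_mul_transpose_mul_comm {S : Matrix (Fin d) (Fin d) ℝ} (hS : Sᵀ = S)
    (X Y : Matrix (Fin k) (Fin d) ℝ) : trace (S * (Xᵀ * Y)) = trace (S * (Yᵀ * X)) := by
  rw [← trace_transpose, transpose_mul, transpose_mul, transpose_transpose, hS, trace_mul_comm]

/-- The cost difference formula for two stable gains. -/
theorem cost_sub_cost (hS₀ : S₀.PosSemidef) (hK : K ∈ s.stableSet) (hK' : K' ∈ s.stableSet) :
    s.cost S₀ K' - s.cost S₀ K =
      2 * trace (lyap (s.A - s.B * K') s.Ψ * ((K' - K)ᵀ * s.advantageMatrix K)) +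
      trace (lyap (s.A - s.B * K') s.Ψ *
        ((K' - K)ᵀ * (s.R + s.Bᵀ * s.valueMatrix K * s.B) * (K' - K))) := by
  have hP := (IsStable.transpose hK).lyap_eq (s.Q + Kᵀ * s.R * K)
  rw [transpose_transpose] at hP
  change s.valueMatrix K = _ + (s.A - s.B * K)ᵀ * s.valueMatrix K * (s.A - s.B * K) at hP
  have hPsymm : (s.valueMatrix K)ᵀ = s.valueMatrix K := (s.valueMatrix_posSemidef hK).1
  have hRsymm : s.Rᵀ = s.R := s.hR.1
  have hSsymm : (lyap (s.A - s.B * K') s.Ψ)ᵀ = lyap (s.A - s.B * K') s.Ψ :=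
    (IsStable.lyap_posSemidef hK' s.hΨ.posSemidef).1
  -- Duality is applied twice: with the closed loop of `K` to write its cost as `tr(ΨP)`, then with
  -- that of `K'` to express `tr(ΨP)` against `Σ_{K'}`. Both costs become traces against the same
  -- covariance.
  have hJK : s.cost S₀ K = trace (s.Ψ * s.valueMatrix K) := by
    rw [s.cost_eq hS₀ hK, ← IsStable.trace_lyap_mul_sub hK s.Ψ, sub_eq_of_eq_add hP]
  rw [hJK, ← IsStable.trace_lyap_mul_sub hK' s.Ψ (s.valueMatrix K), s.cost_eq hS₀ hK',
    ← trace_sub, ← Matrix.mul_sub, two_mul]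
  conv_rhs => enter [1, 2]; rw [trace_mul_transpose_mul_comm hSsymm]
  rw [← trace_add, ← trace_add, ← Matrix.mul_add, ← Matrix.mul_add]
  congr 2
  have hE : (s.advantageMatrix K)ᵀ = Kᵀ * s.R - (s.A - s.B * K)ᵀ * s.valueMatrix K * s.B := by
    simp only [advantageMatrix, transpose_sub, transpose_mul, transpose_transpose, hPsymm, hRsymm,
      Matrix.mul_assoc]
  rw [hE, advantageMatrix]
  obtain ⟨D, rfl⟩ : ∃ D, K' = K + D := ⟨K' - K, by abel⟩
  have hM : s.A - s.B * (K + D) = (s.A - s.B * K) - s.B * D := by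
    rw [Matrix.mul_add]; abel
  rw [hM, add_sub_cancel_left]
  generalize s.valueMatrix K = P at *
  generalize s.A - s.B * K = M at *
  have h2 : P - (M - s.B * D)ᵀ * P * (M - s.B * D) = (s.Q + Kᵀ * s.R * K) +
      (Mᵀ * P * M - (M - s.B * D)ᵀ * P * (M - s.B * D)) := by
    conv_lhs => enter [1]; rw [hP]
    abel
  rw [h2]
  simp only [transpose_sub, transpose_mul, transpose_add, Matrix.mul_add, Matrix.add_mul,
    Matrix.mul_sub, Matrix.sub_mul, Matrix.mul_assoc]
  abel

/-- Dividing the cost difference formula along `K + tH` by `t` leaves a factor `t` on the quadratic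
term, and the covariance is continuous at `K`. -/
theorem fderiv_cost_eq (hS₀ : S₀.PosSemidef) (hK : K ∈ s.stableSet)
    (H : Matrix (Fin k) (Fin d) ℝ) :
    fderiv ℝ (s.cost S₀) K H =
      2 * trace (lyap (s.A - s.B * K) s.Ψ * (Hᵀ * s.advantageMatrix K)) := by
  have hd : HasFDerivAt (s.cost S₀) (fderiv ℝ (s.cost S₀) K) K :=
    ((s.contDiffAt_cost hS₀ hK (r := 1)).differentiableAt one_ne_zero).hasFDerivAt
  have hline : Tendsto (fun t : ℝ => K + t • H) (𝓝 0) (𝓝 K) := by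
    have : Continuous fun t : ℝ => K + t • H := by fun_prop
    simpa using this.tendsto 0
  have hderiv : HasDerivAt (fun t : ℝ => s.cost S₀ (K + t • H)) (fderiv ℝ (s.cost S₀) K H) 0 :=
    hd.hasLineDerivAt H
  rw [hasDerivAt_iff_tendsto_slope_zero] at hderiv
  set W : Matrix (Fin k) (Fin d) ℝ → Matrix (Fin d) (Fin d) ℝ := fun K => lyap (s.A - s.B * K) s.Ψ
    with hW
  have hWt : Tendsto (fun t : ℝ => W (K + t • H)) (𝓝 0) (𝓝 (W K)) :=
    (s.contDiffAt_stationaryCovariance hK (r := 0)).continuousAt.tendsto.comp hline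
  set S := s.R + s.Bᵀ * s.valueMatrix K * s.B with hS
  have hc : ∀ Y : Matrix (Fin d) (Fin d) ℝ,
      Continuous fun X : Matrix (Fin d) (Fin d) ℝ => trace (X * Y) := by
    intro Y
    fun_prop
  have hlim : Tendsto (fun t : ℝ => 2 * trace (W (K + t • H) * (Hᵀ * s.advantageMatrix K)) +
      t * trace (W (K + t • H) * (Hᵀ * S * H))) (𝓝 0)
      (𝓝 (2 * trace (W K * (Hᵀ * s.advantageMatrix K)) + 0 * trace (W K * (Hᵀ * S * H)))) :=
    ((((hc _).tendsto _).comp hWt).const_mul 2).add (tendsto_id.mul (((hc _).tendsto _).comp hWt))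
  rw [zero_mul, add_zero] at hlim
  refine tendsto_nhds_unique (hderiv.congr' ?_) (hlim.mono_left nhdsWithin_le_nhds)
  have hst : ∀ᶠ t in 𝓝[≠] (0 : ℝ), K + t • H ∈ s.stableSet :=
    (hline.eventually (s.isOpen_stableSet.mem_nhds hK)).filter_mono nhdsWithin_le_nhds
  filter_upwards [hst, self_mem_nhdsWithin] with t ht ht0
  have ht0' : t ≠ 0 := ht0
  have h := s.cost_sub_cost hS₀ hK ht
  rw [add_sub_cancel_left] at h
  rw [zero_add, zero_smul, add_zero, h]
  simp only [transpose_smul, Matrix.smul_mul, Matrix.mul_smul, trace_smul, smul_eq_mul]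
  rw [hW, hS]
  field_simp

/-- Testing the gradient on the direction `E` itself gives `2 tr(Σ_K EᵀE) ≥ 2c‖E‖²`; Cauchy–Schwarz
then cancels one factor `‖E‖`. -/
theorem norm_advantageMatrix_le (hS₀ : S₀.PosSemidef) (hK : K ∈ s.stableSet) {c : ℝ}
    (hcΨ : (s.Ψ - c • (1 : Matrix (Fin d) (Fin d) ℝ)).PosSemidef) :
    2 * c * ‖s.advantageMatrix K‖ ≤ ‖matGradient (s.cost S₀) K‖ := by
  set E := s.advantageMatrix K with hE
  have h1 := mul_norm_sq_le_trace (IsStable.lyap_sub_smul_one_posSemidef hK s.hΨ.posSemidef hcΨ) E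
  have h2 := s.fderiv_cost_eq hS₀ hK E
  rw [← hE, fderiv_eq_trace_matGradient] at h2
  have h3 := (le_abs_self _).trans (abs_trace_transpose_mul_le (matGradient (s.cost S₀) K) E)
  have h4 : trace (E * lyap (s.A - s.B * K) s.Ψ * Eᵀ) =
      trace (lyap (s.A - s.B * K) s.Ψ * (Eᵀ * E)) := by
    rw [Matrix.mul_assoc, trace_mul_comm, Matrix.mul_assoc]
  rw [h2] at h3
  rw [h4] at h1
  rcases (norm_nonneg E).eq_or_lt with h0 | h0
  · rw [← h0, mul_zero]
    exact norm_nonneg _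
  · refine le_of_mul_le_mul_right ?_ h0
    nlinarith

/-- A form of gradient dominance: the cost of a stable gain is bounded in terms of its gradient,
relative to any reference gain. -/
theorem cost_le_add_norm_matGradient (hS₀ : S₀.PosSemidef) (hK : K ∈ s.stableSet)
    (hK' : K' ∈ s.stableSet) {c : ℝ} (hc : 0 < c)
    (hcΨ : (s.Ψ - c • (1 : Matrix (Fin d) (Fin d) ℝ)).PosSemidef) :
    s.cost S₀ K ≤ s.cost S₀ K' +
      ‖lyap (s.A - s.B * K') s.Ψ‖ * ‖K' - K‖ * (‖matGradient (s.cost S₀) K‖ / c) := by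
  have h := s.cost_sub_cost hS₀ hK hK'
  have hS := IsStable.lyap_posSemidef hK' s.hΨ.posSemidef
  set W := lyap (s.A - s.B * K') s.Ψ
  -- The quadratic term has a favourable sign and is dropped. The remaining covariance is that of
  -- the reference gain `K'`, so the bound does not degenerate as `K` nears instability.
  have h1 : 0 ≤ trace (W * ((K' - K)ᵀ * (s.R + s.Bᵀ * s.valueMatrix K * s.B) * (K' - K))) :=
    trace_mul_nonneg hS (posSemidef_transpose_mul_mul
      (s.hR.posSemidef.add (posSemidef_transpose_mul_mul (s.valueMatrix_posSemidef hK) s.B)) _)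
  have h2 : |trace (W * ((K' - K)ᵀ * s.advantageMatrix K))| ≤
      ‖W‖ * ‖K' - K‖ * ‖s.advantageMatrix K‖ := by
    rw [← Matrix.mul_assoc]
    refine (abs_trace_mul_le _ _).trans ?_
    gcongr
    rw [← Matrix.frobenius_norm_transpose (K' - K)]
    exact Matrix.frobenius_norm_mul W (K' - K)ᵀ
  have h3 := s.norm_advantageMatrix_le hS₀ hK hcΨ
  have h4 : 2 * ‖s.advantageMatrix K‖ ≤ ‖matGradient (s.cost S₀) K‖ / c := by
    rw [le_div_iff₀ hc]
    linarith
  have h5 := mul_le_mul_of_nonneg_left h4 (by positivity : 0 ≤ ‖W‖ * ‖K' - K‖)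
  have h6 := (abs_le.1 h2).1
  linarith

end LQRSystem

/-! ### A one-dimensional descent inequality. -/

section DescentLemma

/-- A quadratic upper bound for a function whose derivative is locally Lipschitz with constant
`C` at every interior point. -/
theorem le_quadratic_of_deriv_locally_lipschitz {ψ ψ' : ℝ → ℝ} {T C : ℝ} (hT : 0 ≤ T) (hC : 0 ≤ C)
    (h1 : ∀ t ∈ Set.Icc 0 T, HasDerivAt ψ (ψ' t) t)
    (h2 : ∀ t ∈ Set.Icc 0 T, DifferentiableAt ℝ ψ' t)
    (h3 : ∀ t ∈ Set.Ioo 0 T, ∀ᶠ r in 𝓝 t, |ψ' r - ψ' t| ≤ C * |r - t|) :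
    ψ T ≤ ψ 0 + ψ' 0 * T + C * T ^ 2 / 2 := by
  have hd1 : ∀ t ∈ Set.Icc 0 T, HasDerivAt (fun t => ψ' t - C * t) (deriv ψ' t - C) t := by
    intro t ht
    exact ((h2 t ht).hasDerivAt.sub ((hasDerivAt_id t).const_mul C)).congr_deriv (by simp)
  -- The local Lipschitz bound gives `|ψ''| ≤ C` at each interior point, so no uniform neighbourhood
  -- size is required.
  have ha1 : AntitoneOn (fun t => ψ' t - C * t) (Set.Icc 0 T) := by
    refine antitoneOn_of_deriv_nonpos (convex_Icc _ _)
      (fun t ht => (hd1 t ht).continuousAt.continuousWithinAt) ?_ ?_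
    · intro t ht
      exact (hd1 t (interior_subset ht)).differentiableAt.differentiableWithinAt
    · intro t ht
      rw [(hd1 t (interior_subset ht)).deriv]
      have hb := (h2 t (interior_subset ht)).hasDerivAt.le_of_lip' hC
        (by rw [interior_Icc] at ht; simpa [Real.norm_eq_abs] using h3 t ht)
      linarith [Real.le_norm_self (deriv ψ' t)]
  have hd2 : ∀ t ∈ Set.Icc 0 T,
      HasDerivAt (fun t => ψ t - ψ' 0 * t - C / 2 * t ^ 2) (ψ' t - ψ' 0 - C * t) t := by
    intro t ht
    convert! ((h1 t ht).sub ((hasDerivAt_id t).const_mul (ψ' 0))).sub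
      (((hasDerivAt_id t).pow 2).const_mul (C / 2)) using 1
    simp
    ring
  have ha2 : AntitoneOn (fun t => ψ t - ψ' 0 * t - C / 2 * t ^ 2) (Set.Icc 0 T) := by
    refine antitoneOn_of_deriv_nonpos (convex_Icc _ _)
      (fun t ht => (hd2 t ht).continuousAt.continuousWithinAt) ?_ ?_
    · intro t ht
      exact (hd2 t (interior_subset ht)).differentiableAt.differentiableWithinAt
    · intro t ht
      have ht' := interior_subset ht
      rw [(hd2 t ht').deriv]
      have := ha1 (Set.left_mem_Icc.2 hT) ht' ht'.1
      simp only [mul_zero, sub_zero] at this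
      linarith
  have := ha2 (Set.left_mem_Icc.2 hT) (Set.right_mem_Icc.2 hT) hT
  simp only [mul_zero, sub_zero] at this
  nlinarith

end DescentLemma

/-! ### The meta-objective: regularity, closed sublevel sets and descent. -/

section MetaObjective

variable {d k : ℕ} {ι : Type*} (sys : ι → LQRSystem d k) (p : ι → ℝ)
  {S₀ : Matrix (Fin d) (Fin d) ℝ} {η : ℝ} {K K₀ : Matrix (Fin k) (Fin d) ℝ}

theorem contDiffAt_adapt (s : LQRSystem d k) (hS₀ : S₀.PosSemidef) (hK : K ∈ s.stableSet)
    {r : ℕ} : ContDiffAt ℝ r (adapt s S₀ η) K :=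
  contDiffAt_id.sub (contDiffAt_const.fun_smul
    (contDiffAt_matGradient (s.contDiffAt_cost hS₀ hK (r := (r : WithTop ℕ∞) + 1)) le_rfl))

theorem isOpen_metaDomain [Finite ι] (hS₀ : S₀.PosSemidef) :
    IsOpen (metaDomain sys S₀ η) := by
  rw [isOpen_iff_mem_nhds]
  intro K hK
  refine eventually_all.2 fun i => ?_
  refine ((sys i).isOpen_stableSet.eventually_mem (hK i).1).and ?_
  exact (contDiffAt_adapt (r := 0) (sys i) hS₀ (hK i).1).continuousAt.eventually
    ((sys i).isOpen_stableSet.mem_nhds (hK i).2)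

variable [Fintype ι]

theorem contDiffAt_metaObjective (hS₀ : S₀.PosSemidef) (hK : K ∈ metaDomain sys S₀ η) {r : ℕ} :
    ContDiffAt ℝ r (metaObjective sys p S₀ η) K := by
  refine ContDiffAt.sum (f := fun i K => p i * (sys i).cost S₀ (adapt (sys i) S₀ η K)) fun i _ => ?_
  exact contDiffAt_const.mul (((sys i).contDiffAt_cost hS₀ (hK i).2).comp K
    (contDiffAt_adapt (sys i) hS₀ (hK i).1))

theorem contDiffAt_matGradient_metaObjective (hS₀ : S₀.PosSemidef)
    (hK : K ∈ metaDomain sys S₀ η) :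
    ContDiffAt ℝ 1 (matGradient (metaObjective sys p S₀ η)) K :=
  contDiffAt_matGradient (contDiffAt_metaObjective sys p hS₀ hK (r := 2)) (by norm_num)

variable {p}

theorem metaObjective_nonneg (hp : ∀ i, 0 < p i) (hS₀ : S₀.PosSemidef)
    (hK : K ∈ metaDomain sys S₀ η) : 0 ≤ metaObjective sys p S₀ η K :=
  Finset.sum_nonneg fun i _ => mul_nonneg (hp i).le ((sys i).cost_nonneg hS₀ (hK i).2)

theorem cost_adapt_le_of_mem_metaSublevel (hp : ∀ i, 0 < p i) (hS₀ : S₀.PosSemidef)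
    (hK : K ∈ metaSublevel sys p S₀ η K₀) (i : ι) :
    (sys i).cost S₀ (adapt (sys i) S₀ η K) ≤ metaObjective sys p S₀ η K₀ / p i := by
  rw [le_div_iff₀ (hp i), mul_comm]
  refine (Finset.single_le_sum (f := fun i => p i * (sys i).cost S₀ (adapt (sys i) S₀ η K))
    (fun j _ => mul_nonneg (hp j).le ((sys j).cost_nonneg hS₀ (hK.1 j).2))
    (Finset.mem_univ i)).trans hK.2

/-- The danger is a limit at which `K` becomes unstable although the adapted gains keep bounded
cost. The bounded gradient and gradient dominance relative to `K₀` exclude it; stability of the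
adapted limit then follows from continuity of `adapt` at the stable limit. -/
theorem isClosed_metaSublevel (hp : ∀ i, 0 < p i) (hS₀ : S₀.PosSemidef) (hη : 0 < η)
    (hK₀ : K₀ ∈ metaDomain sys S₀ η) : IsClosed (metaSublevel sys p S₀ η K₀) := by
  have : SequentialSpace (Matrix (Fin k) (Fin d) ℝ) :=
    inferInstanceAs (SequentialSpace (Fin k → Fin d → ℝ))
  refine IsSeqClosed.isClosed fun u K hu hlim => ?_
  have hstable : ∀ i, K ∈ (sys i).stableSet := by
    intro i
    obtain ⟨c, hc, hcK⟩ := (sys i).exists_mul_norm_sq_le_cost hS₀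
    obtain ⟨e, he, heΨ⟩ := exists_pos_sub_smul_one_posSemidef (sys i).hΨ
    obtain ⟨b, hb⟩ := (Metric.isBounded_range_of_tendsto u hlim).exists_norm_le
    have hb' : ∀ n, ‖u n‖ ≤ b := fun n => hb _ (Set.mem_range_self n)
    have hadapt : ∀ n, ‖adapt (sys i) S₀ η (u n)‖ ≤ √(metaObjective sys p S₀ η K₀ / p i / c) := by
      intro n
      apply Real.le_sqrt_of_sq_le
      rw [le_div_iff₀ hc, mul_comm]
      exact (hcK _ ((hu n).1 i).2).trans (cost_adapt_le_of_mem_metaSublevel sys hp hS₀ (hu n) i)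
    set a := √(metaObjective sys p S₀ η K₀ / p i / c)
    -- The gradient is recovered from the adaptation step, which is where `η > 0` enters.
    have hgrad : ∀ n, ‖matGradient ((sys i).cost S₀) (u n)‖ ≤ (b + a) / η := by
      intro n
      rw [le_div_iff₀ hη, mul_comm, ← norm_smul_of_nonneg hη.le]
      have : η • matGradient ((sys i).cost S₀) (u n) = u n - adapt (sys i) S₀ η (u n) := by
        rw [adapt, sub_sub_cancel]
      rw [this]
      exact (norm_sub_le _ _).trans (add_le_add (hb' n) (hadapt n))
    refine (sys i).mem_stableSet_of_tendsto hS₀ (fun n => ((hu n).1 i).1) (fun n => ?_) hlim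
      (C := (sys i).cost S₀ K₀ + ‖lyap ((sys i).A - (sys i).B * K₀) (sys i).Ψ‖ *
        (‖K₀‖ + b) * ((b + a) / η / e))
    refine ((sys i).cost_le_add_norm_matGradient hS₀ ((hu n).1 i).1 (hK₀ i).1 he heΨ).trans ?_
    have h1 : ‖K₀ - u n‖ ≤ ‖K₀‖ + b := (norm_sub_le _ _).trans (add_le_add le_rfl (hb' n))
    have h2 := hgrad n
    have h3 : 0 ≤ ‖K₀‖ + b := (norm_nonneg _).trans h1
    gcongr
  have hdom : K ∈ metaDomain sys S₀ η := by
    refine fun i => ⟨hstable i, ?_⟩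
    exact (sys i).mem_stableSet_of_tendsto hS₀ (fun n => ((hu n).1 i).2)
      (fun n => cost_adapt_le_of_mem_metaSublevel sys hp hS₀ (hu n) i)
      ((contDiffAt_adapt (r := 0) (sys i) hS₀ (hstable i)).continuousAt.tendsto.comp hlim)
  exact ⟨hdom, le_of_tendsto' ((contDiffAt_metaObjective (r := 0) sys p hS₀
    hdom).continuousAt.tendsto.comp hlim) fun n => (hu n).2⟩

/-- The meta-gradient is Lipschitz on a bounded sublevel set. -/
theorem exists_lipschitz_matGradient_metaObjective (hp : ∀ i, 0 < p i) (hS₀ : S₀.PosSemidef)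
    (hη : 0 < η) (hK₀ : K₀ ∈ metaDomain sys S₀ η)
    (hb : Bornology.IsBounded (metaSublevel sys p S₀ η K₀)) :
    ∃ L : ℝ, 0 < L ∧ ∀ K ∈ metaSublevel sys p S₀ η K₀, ∀ K' ∈ metaSublevel sys p S₀ η K₀,
      ‖matGradient (metaObjective sys p S₀ η) K - matGradient (metaObjective sys p S₀ η) K'‖ ≤
        L * ‖K - K'‖ := by
  have : ProperSpace (Matrix (Fin k) (Fin d) ℝ) := FiniteDimensional.proper ℝ _
  have hcomp : IsCompact (metaSublevel sys p S₀ η K₀) :=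
    Metric.isCompact_of_isClosed_isBounded (isClosed_metaSublevel sys hp hS₀ hη hK₀) hb
  have hloc : LocallyLipschitzOn (metaSublevel sys p S₀ η K₀)
      (matGradient (metaObjective sys p S₀ η)) := by
    intro K hK
    obtain ⟨C, t, ht, hC⟩ :=
      (contDiffAt_matGradient_metaObjective sys p hS₀ hK.1).exists_lipschitzOnWith
    exact ⟨C, t, mem_nhdsWithin_of_mem_nhds ht, hC⟩
  obtain ⟨C, hC⟩ := hloc.exists_lipschitzOnWith_of_compact hcomp
  -- Adding one makes the constant strictly positive even if `C = 0`.
  refine ⟨C + 1, by positivity, fun K hK K' hK' => ?_⟩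
  refine (hC.norm_sub_le hK hK').trans ?_
  gcongr
  linarith

theorem hasDerivAt_metaObjective_line (hS₀ : S₀.PosSemidef) (g : Matrix (Fin k) (Fin d) ℝ)
    {t : ℝ} (ht : K - t • g ∈ metaDomain sys S₀ η) :
    HasDerivAt (fun t : ℝ => metaObjective sys p S₀ η (K - t • g))
      (-trace ((matGradient (metaObjective sys p S₀ η) (K - t • g))ᵀ * g)) t := by
  have h1 : HasDerivAt (fun t : ℝ => K - t • g) (-g) t := by
    exact (((hasDerivAt_id t).smul_const g).const_sub K).congr_deriv (by simp)
  have h2 := ((contDiffAt_metaObjective sys p hS₀ ht (r := 1)).differentiableAt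
    (by norm_num)).hasFDerivAt.comp_hasDerivAt t h1
  refine h2.congr_deriv ?_
  rw [← fderiv_eq_trace_matGradient]
  exact map_neg _ g

theorem differentiableAt_matGradient_metaObjective_line (hS₀ : S₀.PosSemidef)
    (g : Matrix (Fin k) (Fin d) ℝ) {t : ℝ} (ht : K - t • g ∈ metaDomain sys S₀ η) :
    DifferentiableAt ℝ
      (fun t : ℝ => -trace ((matGradient (metaObjective sys p S₀ η) (K - t • g))ᵀ * g)) t := by
  have h1 : ContDiffAt ℝ 1 (fun t : ℝ => K - t • g) t :=
    contDiffAt_const.sub (contDiffAt_id.smul contDiffAt_const)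
  have h2 := (contDiffAt_matGradient_metaObjective sys p hS₀ ht).comp t h1
  exact ((h2.matrix_transpose.matrix_mul contDiffAt_const).matrix_trace.neg).differentiableAt
    one_ne_zero

/-- Sufficient decrease along the negative gradient, as long as it stays in the sublevel set. -/
theorem metaObjective_le_of_segment (hS₀ : S₀.PosSemidef) {L : ℝ} (hL : 0 < L)
    (hLip : IsPerturbationLipschitzOn (matGradient (metaObjective sys p S₀ η))
      (metaSublevel sys p S₀ η K₀) L) {T : ℝ} (hT : 0 ≤ T) (hTL : T ≤ 1 / L)
    (hseg : ∀ t ∈ Set.Icc 0 T,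
      K - t • matGradient (metaObjective sys p S₀ η) K ∈ metaSublevel sys p S₀ η K₀) :
    metaObjective sys p S₀ η (K - T • matGradient (metaObjective sys p S₀ η) K) ≤
      metaObjective sys p S₀ η K - T / 2 * ‖matGradient (metaObjective sys p S₀ η) K‖ ^ 2 := by
  set G := matGradient (metaObjective sys p S₀ η) with hG
  set g := G K with hg
  have hline : Continuous fun t : ℝ => K - t • g := by fun_prop
  -- Along the line the slope is `-⟨∇𝓛, g⟩`, hence Lipschitz with constant `L‖g‖²`: one factor `‖g‖`
  -- comes from the displacement and one from the pairing. With `LT ≤ 1` the quadratic term costs at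
  -- most half of the linear gain `T‖g‖²`.
  have h := le_quadratic_of_deriv_locally_lipschitz (T := T) (C := L * ‖g‖ ^ 2)
    (ψ := fun t : ℝ => metaObjective sys p S₀ η (K - t • g))
    (ψ' := fun t : ℝ => -trace ((G (K - t • g))ᵀ * g)) hT (by positivity)
    (fun t ht => hasDerivAt_metaObjective_line sys hS₀ g (hseg t ht).1)
    (fun t ht => differentiableAt_matGradient_metaObjective_line sys hS₀ g (hseg t ht).1) ?_
  · simp only [zero_smul, sub_zero, ← hg, ← frobenius_norm_sq_eq_trace] at h
    have h1 : L * T ≤ 1 := by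
      rw [le_div_iff₀ hL] at hTL
      linarith
    have h2 := mul_le_mul_of_nonneg_right h1 (by positivity : 0 ≤ T * ‖g‖ ^ 2)
    nlinarith
  · intro t ht
    obtain ⟨δ, hδ, hδL⟩ := hLip _ (hseg t (Set.Ioo_subset_Icc_self ht))
    have hnear : ∀ᶠ r in 𝓝 t, ‖(K - t • g) - (K - r • g)‖ < δ := by
      have hc : Continuous fun r : ℝ => ‖(K - t • g) - (K - r • g)‖ := by fun_prop
      exact hc.continuousAt.eventually_lt_const (by simpa using hδ)
    filter_upwards [hnear, Ioo_mem_nhds ht.1 ht.2] with r hr hr'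
    have h1 := hδL _ (hseg r (Set.Ioo_subset_Icc_self hr')) hr.le
    have h2 : ‖(K - t • g) - (K - r • g)‖ = |r - t| * ‖g‖ := by
      rw [sub_sub_sub_cancel_left, ← sub_smul, norm_smul, Real.norm_eq_abs]
    have h3 : -trace ((G (K - r • g))ᵀ * g) - -trace ((G (K - t • g))ᵀ * g) =
        trace ((G (K - t • g) - G (K - r • g))ᵀ * g) := by
      rw [transpose_sub, Matrix.sub_mul, trace_sub]
      ring
    rw [h3]
    refine (abs_trace_transpose_mul_le _ _).trans ?_
    calc _ ≤ L * (|r - t| * ‖g‖) * ‖g‖ := by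
          rw [← h2]
          gcongr
      _ = L * ‖g‖ ^ 2 * |r - t| := by ring

/-- One gradient step of length at most `1 / L` stays in the sublevel set. -/
theorem sub_smul_matGradient_mem_metaSublevel (hp : ∀ i, 0 < p i) (hS₀ : S₀.PosSemidef)
    (hη : 0 < η) (hK₀ : K₀ ∈ metaDomain sys S₀ η) {L : ℝ} (hL : 0 < L)
    (hLip : IsPerturbationLipschitzOn (matGradient (metaObjective sys p S₀ η))
      (metaSublevel sys p S₀ η K₀) L) (hK : K ∈ metaSublevel sys p S₀ η K₀)
    {α : ℝ} (hαL : α ≤ 1 / L) :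
    ∀ t ∈ Set.Icc 0 α,
      K - t • matGradient (metaObjective sys p S₀ η) K ∈ metaSublevel sys p S₀ η K₀ := by
  set G := matGradient (metaObjective sys p S₀ η) with hG
  set g := G K with hg
  have hline : Continuous fun t : ℝ => K - t • g := by fun_prop
  rcases eq_or_ne g 0 with hg0 | hg0
  · intro t _
    simpa [hg0] using hK
  have hg1 : 0 < ‖g‖ ^ 2 := by positivity
  set U : Set ℝ := {t | K - t • g ∈ metaSublevel sys p S₀ η K₀} with hU
  have hUclosed : IsClosed U := (isClosed_metaSublevel sys hp hS₀ hη hK₀).preimage hline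
  have hnhds : ∀ t, K - t • g ∈ metaDomain sys S₀ η →
      metaObjective sys p S₀ η (K - t • g) < metaObjective sys p S₀ η K₀ → U ∈ 𝓝 t := by
    intro t h1 h2
    have hev := ((isOpen_metaDomain sys hS₀).eventually_mem h1).and
      ((contDiffAt_metaObjective sys p hS₀ h1 (r := 0)).continuousAt.eventually_lt_const h2)
    filter_upwards [hline.continuousAt.eventually hev] with r hr
    exact ⟨hr.1, hr.2.le⟩
  -- Continuous induction runs on the times up to which the entire segment stays in the sublevel
  -- set, since the decrease estimate needs the whole segment.
  set V : Set ℝ := {t | ∀ r ∈ Set.Icc 0 t, r ∈ U} with hV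
  have hVclosed : IsClosed (V ∩ Set.Icc 0 α) := by
    refine IsSeqClosed.isClosed fun u x hu hlim => ⟨fun r hr => ?_, ?_⟩
    · have h1 : Tendsto (fun n => min r (u n)) atTop (𝓝 r) := by
        simpa [min_eq_left hr.2] using (tendsto_const_nhds (x := r)).min hlim
      exact hUclosed.mem_of_tendsto h1 (Eventually.of_forall fun n =>
        (hu n).1 _ ⟨le_min hr.1 (hu n).2.1, min_le_right _ _⟩)
    · exact isClosed_Icc.mem_of_tendsto hlim (Eventually.of_forall fun n => (hu n).2)
  have h0V : (0 : ℝ) ∈ V := by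
    intro r hr
    have : r = 0 := le_antisymm hr.2 hr.1
    subst this
    simpa [hU] using hK
  have hV_sub : Set.Icc 0 α ⊆ V := by
    refine hVclosed.Icc_subset_of_forall_mem_nhdsWithin h0V ?_
    rintro x ⟨hxV, hx0, hxα⟩
    have hUx : U ∈ 𝓝[>] x := by
      -- At time zero the value may equal that at `K₀`, so the negative derivative `-‖g‖²` supplies
      -- a right neighbourhood only. At positive times sufficient decrease makes the inequality
      -- strict, and openness applies.
      rcases hx0.eq_or_lt with rfl | hx0
      · have hderiv := hasDerivAt_metaObjective_line (K := K) (t := 0) (p := p) sys hS₀ g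
          (by simpa using hK.1)
        rw [zero_smul, sub_zero, ← hG, ← hg, ← frobenius_norm_sq_eq_trace,
          hasDerivAt_iff_tendsto_slope_zero] at hderiv
        have hneg := (hderiv.eventually_lt_const (neg_neg_of_pos hg1)).filter_mono
          (nhdsWithin_mono 0 fun x (hx : 0 < x) => hx.ne')
        have hdom : ∀ᶠ t in 𝓝[>] (0 : ℝ), K - t • g ∈ metaDomain sys S₀ η :=
          (hline.continuousAt.eventually ((isOpen_metaDomain sys hS₀).eventually_mem
            (by simpa using hK.1))).filter_mono nhdsWithin_le_nhds
        filter_upwards [hneg, hdom, self_mem_nhdsWithin] with t ht1 ht2 ht3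
        refine ⟨ht2, ?_⟩
        rw [zero_add, zero_smul, sub_zero, smul_eq_mul] at ht1
        have h1 : (0 : ℝ) < t⁻¹ := inv_pos.2 ht3
        have h2 : metaObjective sys p S₀ η (K - t • g) - metaObjective sys p S₀ η K < 0 := by
          by_contra! h
          exact absurd ht1 (not_lt.2 (mul_nonneg h1.le h))
        linarith [hK.2]
      · refine mem_nhdsWithin_of_mem_nhds (hnhds x (hxV x ⟨hx0.le, le_rfl⟩).1 ?_)
        have h1 := metaObjective_le_of_segment sys hS₀ hL hLip hx0.le (hxα.le.trans hαL)
          (K := K) hxV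
        have h2 : 0 < x / 2 * ‖g‖ ^ 2 := by positivity
        exact lt_of_lt_of_le (by linarith) hK.2
    obtain ⟨y, hy, hyU⟩ := mem_nhdsGT_iff_exists_Ioo_subset.1 hUx
    filter_upwards [Ioo_mem_nhdsGT hy] with t ht r hr
    rcases le_or_gt r x with h | h
    · exact hxV r ⟨hr.1, h⟩
    · exact hyU ⟨h, hr.2.trans_lt ht.2⟩
  exact fun t ht => hV_sub ht t ⟨ht.1, le_rfl⟩

end MetaObjective

end MetaLQR

end

/-! ### Convergence of exact gradient descent. -/

theorem mainTheorem1 {d k : ℕ} {ι : Type*} [Fintype ι]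
    (sys : ι → MetaLQR.LQRSystem d k)
    (p : ι → ℝ) (hp : ∀ i, 0 < p i) (hp1 : ∑ i, p i = 1)
    (S₀ : Matrix (Fin d) (Fin d) ℝ) (hS₀ : S₀.PosSemidef)
    (η : ℝ) (hη : 0 < η)
    (K₀ : Matrix (Fin k) (Fin d) ℝ) (hK₀ : K₀ ∈ MetaLQR.metaDomain sys S₀ η) :
    -- a constant `L` as required below exists whenever the sublevel set of `K₀` is bounded
    (Bornology.IsBounded (MetaLQR.metaSublevel sys p S₀ η K₀) →
      ∃ L : ℝ, 0 < L ∧ ∀ K ∈ MetaLQR.metaSublevel sys p S₀ η K₀,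
        ∀ K' ∈ MetaLQR.metaSublevel sys p S₀ η K₀,
          ‖MetaLQR.matGradient (MetaLQR.metaObjective sys p S₀ η) K
            - MetaLQR.matGradient (MetaLQR.metaObjective sys p S₀ η) K'‖ ≤ L * ‖K - K'‖) ∧
    -- convergence of exact gradient descent started at `K₀`
    (∀ L : ℝ, 0 < L →
      MetaLQR.IsPerturbationLipschitzOn
        (MetaLQR.matGradient (MetaLQR.metaObjective sys p S₀ η))
        (MetaLQR.metaSublevel sys p S₀ η K₀) L →
      ∀ α : ℝ, 0 < α → α ≤ 1 / L →
      ∀ K : ℕ → Matrix (Fin k) (Fin d) ℝ, K 0 = K₀ →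
        (∀ n, K (n + 1) =
          K n - α • MetaLQR.matGradient (MetaLQR.metaObjective sys p S₀ η) (K n)) →
        (∀ n, K n ∈ MetaLQR.metaDomain sys S₀ η ∧
          DifferentiableAt ℝ (MetaLQR.metaObjective sys p S₀ η) (K n)) ∧
        Tendsto (fun n => ‖MetaLQR.matGradient (MetaLQR.metaObjective sys p S₀ η) (K n)‖)
          atTop (𝓝 0)) := by
  refine ⟨MetaLQR.exists_lipschitz_matGradient_metaObjective sys hp hS₀ hη hK₀, ?_⟩
  intro L hL hLip α hα hαL K hK0 hstep
  have hmem : ∀ n, K n ∈ MetaLQR.metaSublevel sys p S₀ η K₀ := by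
    intro n
    induction n with
    | zero => rw [hK0]; exact ⟨hK₀, le_rfl⟩
    | succ n ih =>
      rw [hstep n]
      exact MetaLQR.sub_smul_matGradient_mem_metaSublevel sys hp hS₀ hη hK₀ hL hLip ih hαL α
        ⟨hα.le, le_rfl⟩
  have hdec : ∀ n, α / 2 * ‖MetaLQR.matGradient (MetaLQR.metaObjective sys p S₀ η) (K n)‖ ^ 2 ≤
      MetaLQR.metaObjective sys p S₀ η (K n) - MetaLQR.metaObjective sys p S₀ η (K (n + 1)) := by
    intro n
    have h := MetaLQR.metaObjective_le_of_segment sys hS₀ hL hLip hα.le hαL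
      (MetaLQR.sub_smul_matGradient_mem_metaSublevel sys hp hS₀ hη hK₀ hL hLip (hmem n) hαL)
    rw [← hstep n] at h
    linarith
  refine ⟨fun n => ⟨(hmem n).1, (MetaLQR.contDiffAt_metaObjective sys p hS₀ (hmem n).1
    (r := 1)).differentiableAt (by norm_num)⟩, ?_⟩
  -- The decreases telescope, and nonnegativity of the meta-objective bounds every partial sum by
  -- its initial value.
  have hsum : Summable fun n =>
      α / 2 * ‖MetaLQR.matGradient (MetaLQR.metaObjective sys p S₀ η) (K n)‖ ^ 2 := by
    refine summable_of_sum_range_le (c := MetaLQR.metaObjective sys p S₀ η (K 0))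
      (fun n => by positivity) fun N => ?_
    refine (Finset.sum_le_sum fun n _ => hdec n).trans ?_
    rw [Finset.sum_range_sub']
    linarith [MetaLQR.metaObjective_nonneg sys hp hS₀ (hmem N).1]
  have hsq : Tendsto
      (fun n => ‖MetaLQR.matGradient (MetaLQR.metaObjective sys p S₀ η) (K n)‖ ^ 2) atTop (𝓝 0) := by
    have h := hsum.tendsto_atTop_zero.const_mul (2 / α)
    rw [mul_zero] at h
    refine h.congr fun n => ?_
    field_simp
  have h := hsq.sqrt
  rw [Real.sqrt_zero] at h
  exact h.congr fun n => Real.sqrt_sq (norm_nonneg _)
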